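/- **Model.** A radio network is a simple connected undirected graph with $n$ nodes, diameter $D$ and maximum degree $\Delta$. Nodes act in synchronous rounds. In each round a node either transmits a packet of arbitrary size to all its neighbours or listens; a listening node hears a packet iff exactly one of its neighbours transmits, and cannot distinguish silence from a collision. In the $k$-gathering problem there are $k\ge 1$ source nodes, each holding a message, and a sink node, and all messages have to reach the sink; messages can be combined into one packet. Only the sources are awake at round $0$; any other node wakes up when it first receives a packet. All nodes execute the same deterministic algorithm, and the time on an instance is the number of rounds until the sink has all messages. In the *distinct-ID model* the nodes are given arbitrary distinct IDs from $\{1,\dots,n\}$; initially each node knows only its ID, whether it is a source, and whether it is the sink, but the algorithm may depend on $n,D,k$. In the *advice model* each node instead initially knows only whether it is a source and a binary label, assigned to it by an oracle that knows the whole instance. All logarithms are to base $2$. **Theorem.** (1) There is a constant $c>0$ such that for all integers $n,D,k$ with $D\ge 2$, $k\ge 1$ and $2D+k\le n+1$ (that is, $D-1<(n-k)/2$), every deterministic $k$-gathering algorithm in the distinct-ID model needs, on some instance with $n$ nodes, diameter $D$ and $k$ sources and for some assignment of IDs, at least $$c\,\bigl(D\log n+k\log(n/k)\bigr)$$ rounds.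 (2) Consequently there is an $\Omega(\log n)$ time gap to algorithms with advice for $k=O(n^{\varepsilon})$: (a) there are a single deterministic algorithm and a constant $C>0$ such that in the advice model, for every instance with $k\ge1$ there are labels of length at most $C\,(1+\min(\log k,\log\Delta))$ with which the algorithm accomplishes $k$-gathering in at most $C(D+k)$ rounds (for $\Delta=0$ read $\log\Delta=0$); (b) for all $0<\varepsilon<1$ and $K>0$ there is $c'>0$ such that for all $n,D,k$ as in (1) with $k\le Kn^{\varepsilon}$, every deterministic algorithm in the distinct-ID model needs, on some instance with $n$ nodes, diameter $D$ and $k$ sources and for some assignment of IDs, at least $c'\,(D+k)\log n$ rounds. -/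

import Mathlib

/-- A deterministic distributed algorithm for radio networks in the non-spontaneous wake-up model,
executed by every node; the only initial knowledge of a node is its label in `Λ` (and whether it
is a source). `start` is the initial state of a source. A node that is not a source sleeps until
it receives its first packet, and then takes the state given by `wake`. An awake node in state `s`
transmits the packet `p` if `send s = some p`, and listens if `send s = none`. After each round its
state is updated by `step`, which is given the packet heard in that round; `none` stands for
silence, for a collision (the two are not distinguishable), and for a round in which the node
itself transmitted. Packets are arbitrary, there is no restriction on their size. -/
structure RadioAlgorithm (Λ : Type) where
  State : Type
  Packet : Type
  start : Λ → State
  wake : Λ → Packet → State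
  send : State → Option Packet
  step : State → Option Packet → State

section Radio

variable {V : Type}

/-- If the nodes transmit as prescribed by `tx` in some round (`none` means that a node does not
transmit), the node `v` hears the node `w` in that round iff `v` does not transmit and `w` is the
only neighbour of `v` that transmits. -/
def Hears {P : Type} (G : SimpleGraph V) (tx : V → Option P) (v w : V) : Prop :=
  tx v = none ∧ G.Adj v w ∧ tx w ≠ none ∧ ∀ u, G.Adj v u → tx u ≠ none → u = w

open Classical in
/-- The packet heard by `v`, if any (the node `w` heard by `v` is unique). -/
noncomputable def received {P : Type} (G : SimpleGraph V) (tx : V → Option P) (v : V) :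
    Option P :=
  if h : ∃ w, Hears G tx v w then tx h.choose else none

namespace RadioAlgorithm

variable {Λ : Type} (A : RadioAlgorithm Λ)

/-- The state of a node after a round with received packet `r`; `none` is a sleeping node. -/
def next (l : Λ) : Option A.State → Option A.Packet → Option A.State
  | none, none => none
  | none, some p => some (A.wake l p)
  | some s, r => some (A.step s r)

open Classical in
/-- The states of the nodes at the beginning of round `t` (rounds are `0, 1, 2, …`), in the network
`G` with labels `lab` and set of sources `S`. Sleeping nodes have the value `none`. -/
noncomputable def state (G : SimpleGraph V) (lab : V → Λ) (S : Finset V) :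
    ℕ → V → Option A.State
  | 0, v => if v ∈ S then some (A.start (lab v)) else none
  | t + 1, v => A.next (lab v) (state G lab S t v)
      (received G (fun u => (state G lab S t u).bind A.send) v)

/-- The packets transmitted in round `t`. -/
noncomputable def transmits (G : SimpleGraph V) (lab : V → Λ) (S : Finset V) (t : ℕ) (v : V) :
    Option A.Packet :=
  (A.state G lab S t v).bind A.send

/-- The sources whose messages have reached the node `v` within the first `t` rounds. Messages can
be combined, so that every transmission carries all source messages which the transmitter has. -/
def known (G : SimpleGraph V) (lab : V → Λ) (S : Finset V) : ℕ → V → Set V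
  | 0, v => {u | u ∈ S ∧ u = v}
  | t + 1, v => known G lab S t v ∪
      {u | ∃ w, Hears G (A.transmits G lab S t) v w ∧ u ∈ known G lab S t w}

end RadioAlgorithm

end Radio

/-- An instance of the `k`-gathering problem: a simple connected graph with `n` nodes and diameter
`D`, a set of `k` source nodes, and a sink node. -/
structure GatheringInstance (n D k : ℕ) where
  graph : SimpleGraph (Fin n)
  connected : graph.Connected
  diam_eq : graph.diam = D
  sources : Finset (Fin n)
  card_sources : sources.card = k
  sink : Fin n

namespace GatheringInstance

variable {n D k : ℕ} (I : GatheringInstance n D k)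

open Classical in
/-- The maximum degree `Δ` of the network. -/
noncomputable def maxDegree : ℕ := I.graph.maxDegree

/-- With the labels `lab`, the algorithm `A` brings the messages of all sources to the sink within
the first `T` rounds. -/
def SolvedWithin {Λ : Type} (A : RadioAlgorithm Λ) (lab : Fin n → Λ) (T : ℕ) : Prop :=
  ∀ u ∈ I.sources, u ∈ A.known I.graph lab I.sources T I.sink

/-- Every node initially knows its ID, and whether it is the sink. -/
def idLabel (ident : Fin n → ℕ) (v : Fin n) : ℕ × Bool := (ident v, decide (v = I.sink))

end GatheringInstance

/-- `ident` assigns distinct IDs from `{1, …, n}` to the `n` nodes. -/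
def IsIDAssignment {n : ℕ} (ident : Fin n → ℕ) : Prop :=
  Function.Injective ident ∧ ∀ v, 1 ≤ ident v ∧ ident v ≤ n

/-- The deterministic algorithm `A`, in which nodes have distinct IDs and no advice, needs at least
`b` rounds in the worst case over the `k`-gathering instances with `n` nodes and diameter `D`, and
over the assignments of distinct IDs from `{1, …, n}`. -/
def RequiresRounds (n D k : ℕ) (A : RadioAlgorithm (ℕ × Bool)) (b : ℝ) : Prop :=
  ∃ (I : GatheringInstance n D k) (ident : Fin n → ℕ), IsIDAssignment ident ∧
    ∀ T : ℕ, I.SolvedWithin A (I.idLabel ident) T → b ≤ (T : ℝ)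

/-!
Lower bounds with distinct IDs. All instances are layered networks, in which two nodes are adjacent
iff their layers are consecutive, and the sources form layer `0`. Three of them are combined.

* A node of layer `i + 1` can be woken only by a round in which exactly one node of layer `i`
  transmits. Until then all nodes of layer `i` receive the same, so that from a pool of candidates
  one can keep, round after round, the larger half that acts in the same way. Neither the candidates
  nor the earlier layers can tell the whole pool from a pair taken from it
  (`AllOrNone.state_agree`), so a pair delays the next layer by the logarithm of the size of the
  pool. Doing so for `D / 2` layers (`exists_slow_layers`) costs `Ω(D log (n - k))` rounds. Either
  `log (n - k - 1)` is of order `log n`, or `k` is of order `n` and the next bound is stronger.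
* If the sink is the only neighbour of the sources, it obtains at most one message per round, so `k`
  rounds are needed.
* In the same network nothing is received before the first round in which exactly one source
  transmits, and until then the behaviour of a source depends on its ID only. By
  `exists_unselected`, for `m` arbitrary sets of IDs, with `m` of order `k log (n / k)`, there is a
  set of exactly `k` IDs that meets none of them in exactly one element. Its proof is
  by counting: `r`-sets with equal parities have symmetric differences that meet every set evenly,
  and among these differences so many meet the same sets that their union has at least `k` elements.

Upper bound with advice. The messages are combined along a breadth-first tree rooted at the sink, in
which each node above a source, except the sink, transmits exactly once. Rank the sources by their
depth. A node at height `h` whose subtree has a source of highest rank `ρ` (this source is also deepest, and `h` is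
measured from it) may transmit in round `h + 3 ρ`: transmitters with different ranks are then at
least three levels apart, so there is no interference (`Active.eq_of_height_add_rank`), and
each node transmits one round after its main child, the child with the same highest rank. Thus
only the nodes at height `0` have to be told their waiting times. Parents are addressed by a
colouring with different colours at distance at most two, with `3 k` or `Δ ^ 2 + Δ + 1` colours.

If `k ≤ Δ ^ 4`, the waiting time can be part of the label. If `k > Δ ^ 4`, a label of length
`O(log Δ)` cannot hold it; then the lowest `r = log k + O(1)` levels follow a time-division
schedule given by the colours, which takes `r (Δ ^ 2 + Δ + 1) = O(k)` rounds, and the nodes at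
height `r` start the fast schedule, with waiting times whose binary digits are
distributed over the labels of the `r + 1` nodes on a path up to there and collected on the way
(`GatheringTree.realizesSchedule`).
-/

/-! ### Reception and waking -/

section Reception

variable {V P : Type} {G : SimpleGraph V} {tx : V → Option P}

theorem Hears.unique {v w w' : V} (h : Hears G tx v w) (h' : Hears G tx v w') : w = w' :=
  h'.2.2.2 w h.2.1 h.2.2.1

theorem received_of_hears {v w : V} (h : Hears G tx v w) : received G tx v = tx w := by
  have hex : ∃ w, Hears G tx v w := ⟨w, h⟩
  rw [received, dif_pos hex, Hears.unique hex.choose_spec h]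

theorem received_eq_none {v : V} (h : ∀ w, ¬ Hears G tx v w) : received G tx v = none := by
  rw [received, dif_neg (not_exists.2 h)]

/-- A node receives the same packet in two networks if it hears the same nodes, and these transmit
the same packets. -/
theorem received_congr {G' : SimpleGraph V} {tx' : V → Option P} {v : V}
    (h : ∀ w, Hears G tx v w ↔ Hears G' tx' v w) (htx : ∀ w, Hears G tx v w → tx w = tx' w) :
    received G tx v = received G' tx' v := by
  by_cases hex : ∃ w, Hears G tx v w
  · obtain ⟨w, hw⟩ := hex
    rw [received_of_hears hw, received_of_hears ((h w).1 hw), htx w hw]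
  · rw [received_eq_none (not_exists.1 hex),
      received_eq_none fun w hw => hex ⟨w, (h w).2 hw⟩]

end Reception

namespace RadioAlgorithm

variable {V Λ : Type} (A : RadioAlgorithm Λ) (G : SimpleGraph V) (lab : V → Λ) (S : Finset V)

theorem state_zero_of_mem {v : V} (h : v ∈ S) :
    A.state G lab S 0 v = some (A.start (lab v)) := by
  simp [state, h]

theorem state_zero_of_notMem {v : V} (h : v ∉ S) : A.state G lab S 0 v = none := by
  simp [state, h]

theorem state_succ (t : ℕ) (v : V) :
    A.state G lab S (t + 1) v = A.next (lab v) (A.state G lab S t v)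
      (received G (A.transmits G lab S t) v) := rfl

variable {G lab S}

theorem transmits_eq_none_of_asleep {t : ℕ} {v : V} (h : A.state G lab S t v = none) :
    A.transmits G lab S t v = none := by
  simp [transmits, h]

theorem transmits_of_state_eq {t : ℕ} {v : V} {s : A.State} (h : A.state G lab S t v = some s) :
    A.transmits G lab S t v = A.send s := by
  simp [transmits, h]

theorem asleep_succ {t : ℕ} {v : V} (h : A.state G lab S t v = none)
    (hr : ∀ w, ¬ Hears G (A.transmits G lab S t) v w) :
    A.state G lab S (t + 1) v = none := by
  rw [state_succ, h, received_eq_none hr]; rfl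

theorem state_succ_ne_none_of_ne_none {t : ℕ} {v : V} (h : A.state G lab S t v ≠ none) :
    A.state G lab S (t + 1) v ≠ none := by
  rw [state_succ]
  cases hs : A.state G lab S t v with
  | none => exact absurd hs h
  | some s => simp [next]

/-- A node that knows a message is awake. -/
theorem state_ne_none_of_mem_known {t : ℕ} {u v : V} (h : u ∈ A.known G lab S t v) :
    A.state G lab S t v ≠ none := by
  induction t generalizing v with
  | zero =>
    obtain ⟨hu, rfl⟩ := h
    simp [A.state_zero_of_mem G lab S hu]
  | succ t ih =>
    rcases h with h | ⟨w, hw, -⟩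
    · exact A.state_succ_ne_none_of_ne_none (ih h)
    · rw [state_succ, received_of_hears hw]
      obtain ⟨p, hp⟩ := Option.ne_none_iff_exists'.1 hw.2.2.1
      rw [hp]
      cases A.state G lab S t v <;> simp [next]

theorem mem_sources_of_mem_known {t : ℕ} {u v : V} (h : u ∈ A.known G lab S t v) : u ∈ S := by
  induction t generalizing v with
  | zero => exact h.1
  | succ t ih =>
    rcases h with h | ⟨w, -, h⟩
    · exact ih h
    · exact ih h

theorem known_mono {t t' : ℕ} (htt : t ≤ t') (v : V) :
    A.known G lab S t v ⊆ A.known G lab S t' v := by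
  induction t', htt using Nat.le_induction with
  | base => exact subset_rfl
  | succ n _ ih => exact ih.trans Set.subset_union_left

end RadioAlgorithm

/-! ### Layered networks -/

/-- The network in which two nodes are adjacent iff their layers are consecutive. -/
def layeredGraph {V : Type} (l : V → ℕ) : SimpleGraph V where
  Adj u v := l u + 1 = l v ∨ l v + 1 = l u
  symm := ⟨fun _ _ h => h.symm⟩
  loopless := ⟨fun _ h => by omega⟩

theorem layeredGraph_adj {V : Type} {l : V → ℕ} {u v : V} :
    (layeredGraph l).Adj u v ↔ l u + 1 = l v ∨ l v + 1 = l u := Iff.rfl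

section Diameter

variable {V : Type} {l : V → ℕ} {D : ℕ}

theorem exists_walk_up (hsurj : ∀ i ≤ D, ∃ v, l v = i) (hle : ∀ v, l v ≤ D) (j : ℕ) :
    ∀ u v, l v = l u + (j + 1) → ∃ p : (layeredGraph l).Walk u v, p.length = j + 1 := by
  induction j with
  | zero =>
    intro u v h
    exact ⟨.cons (layeredGraph_adj.2 (.inl (by omega))) .nil, rfl⟩
  | succ j ih =>
    intro u v h
    obtain ⟨w, hw⟩ := hsurj (l u + 1) (by have := hle v; omega)
    obtain ⟨p, hp⟩ := ih w v (by omega)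
    exact ⟨.cons (layeredGraph_adj.2 (.inl (by omega))) p, by simp [hp]⟩

theorem layer_le_add_length {u v : V} (p : (layeredGraph l).Walk u v) : l v ≤ l u + p.length := by
  induction p with
  | nil => simp
  | cons h p ih =>
    rw [SimpleGraph.Walk.length_cons]
    rcases h with h | h <;> omega

theorem exists_short_walk (hD : 2 ≤ D) (hsurj : ∀ i ≤ D, ∃ v, l v = i) (hle : ∀ v, l v ≤ D)
    (u v : V) : ∃ p : (layeredGraph l).Walk u v, p.length ≤ D := by
  have key : ∀ u v, l u ≤ l v → ∃ p : (layeredGraph l).Walk u v, p.length ≤ D := by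
    intro u v huv
    have h1 := hle v
    rcases huv.eq_or_lt with h | h
    · obtain ⟨w, hw⟩ : ∃ w, l w + 1 = l u ∨ l u + 1 = l w := by
        rcases Nat.eq_zero_or_pos (l u) with h0 | h0
        · obtain ⟨w, hw⟩ := hsurj 1 (by omega)
          exact ⟨w, by omega⟩
        · obtain ⟨w, hw⟩ := hsurj (l u - 1) (by omega)
          exact ⟨w, by omega⟩
      exact ⟨.cons (v := w) (layeredGraph_adj.2 (by omega))
        (.cons (layeredGraph_adj.2 (by omega)) .nil), by simpa using hD⟩
    · obtain ⟨p, hp⟩ := exists_walk_up hsurj hle (l v - l u - 1) u v (by omega)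
      exact ⟨p, by omega⟩
  rcases le_total (l u) (l v) with h | h
  · exact key u v h
  · obtain ⟨p, hp⟩ := key v u h
    exact ⟨p.reverse, by simpa using hp⟩

theorem layeredGraph_connected (hD : 2 ≤ D) (hsurj : ∀ i ≤ D, ∃ v, l v = i) (hle : ∀ v, l v ≤ D) :
    (layeredGraph l).Connected := by
  obtain ⟨v, -⟩ := hsurj 0 (by omega)
  have : Nonempty V := ⟨v⟩
  exact ⟨fun u v => (exists_short_walk hD hsurj hle u v).elim fun p _ => p.reachable⟩

theorem layeredGraph_diam (hD : 2 ≤ D) (hsurj : ∀ i ≤ D, ∃ v, l v = i) (hle : ∀ v, l v ≤ D) :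
    (layeredGraph l).diam = D := by
  have hup : (layeredGraph l).ediam ≤ D := by
    refine SimpleGraph.ediam_le_of_edist_le fun u v => ?_
    obtain ⟨p, hp⟩ := exists_short_walk hD hsurj hle u v
    exact (SimpleGraph.edist_le p).trans (by exact_mod_cast hp)
  have htop : (layeredGraph l).ediam ≠ ⊤ := fun h => by simp [h] at hup
  obtain ⟨u, hu⟩ := hsurj 0 (by omega)
  obtain ⟨v, hv⟩ := hsurj D le_rfl
  apply le_antisymm
  · have := ENat.toNat_le_toNat hup (by simp)
    simpa [SimpleGraph.diam] using this
  · obtain ⟨p, hp⟩ := (layeredGraph_connected hD hsurj hle).exists_walk_length_eq_dist u v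
    have h1 := layer_le_add_length p
    have h2 := SimpleGraph.dist_le_diam htop (u := u) (v := v)
    omega

end Diameter

/-! ### Networks with layers of indistinguishable nodes -/

namespace RadioAlgorithm

variable {V Λ : Type} (A : RadioAlgorithm Λ) (lab : V → Λ) (S : Finset V)

/-- In each of the first `τ` rounds either all nodes of layer `i` transmit or none of them does. -/
def AllOrNone (l : V → ℕ) (i τ : ℕ) : Prop :=
  ∀ t < τ, (∀ v, l v = i → A.transmits (layeredGraph l) lab S t v = none) ∨
    ∀ v, l v = i → A.transmits (layeredGraph l) lab S t v ≠ none

variable {A lab S}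

/-- While the nodes of layer `i` transmit all together or not at all, no later layer wakes up, and
the earlier layers cannot tell layer `i` from a subset of it with at least two nodes. -/
theorem AllOrNone.state_agree {l l' : V → ℕ} {i τ : ℕ} (hA : A.AllOrNone lab S l i τ)
    (hS : ∀ v ∈ S, l' v = 0)
    (h1 : ∀ v, l' v ≤ i → l v = l' v) (h2 : ∀ v, l v < i → l' v = l v)
    (hpair : ∃ a b, a ≠ b ∧ l' a = i ∧ l' b = i) :
    ∀ t ≤ τ, (∀ v, l' v ≤ i → A.state (layeredGraph l') lab S t v =
        A.state (layeredGraph l) lab S t v) ∧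
      (∀ v, i < l' v → A.state (layeredGraph l') lab S t v = none) ∧
      (∀ v, i < l v → A.state (layeredGraph l) lab S t v = none) := by
  obtain ⟨a, b, hab, ha', hb'⟩ := hpair
  have ha : l a = i := (h1 a ha'.le).trans ha'
  have hb : l b = i := (h1 b hb'.le).trans hb'
  intro t
  induction t with
  | zero =>
    intro _
    refine ⟨fun v _ => rfl, fun v hv => A.state_zero_of_notMem _ _ _ fun hvS => ?_,
      fun v hv => A.state_zero_of_notMem _ _ _ fun hvS => ?_⟩
    · have := hS v hvS; omega
    · have := hS v hvS; have := h1 v (by omega); omega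
  | succ t ih =>
    intro ht
    obtain ⟨hst, hsl', hsl⟩ := ih (by omega)
    set tx := A.transmits (layeredGraph l) lab S t with htx
    set tx' := A.transmits (layeredGraph l') lab S t with htx'
    have hcase := hA t (by omega)
    have heq : ∀ v, l' v ≤ i → tx' v = tx v := fun v hv => by
      simp only [htx, htx', transmits, hst v hv]
    have htl : ∀ v, tx v ≠ none → l v ≤ i := fun v hv => by
      by_contra hlt
      exact hv (A.transmits_eq_none_of_asleep (hsl v (by omega)))
    have htl' : ∀ v, tx' v ≠ none → l' v ≤ i := fun v hv => by
      by_contra hlt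
      exact hv (A.transmits_eq_none_of_asleep (hsl' v (by omega)))
    -- a transmitter in layer `i` is accompanied by both `a` and `b`, and so is not heard
    have hall : ∀ w, l w = i → tx w ≠ none → ∀ v, l v = i → tx v ≠ none := by
      intro w hw hwt
      rcases hcase with h | h
      · exact absurd (h w hw) hwt
      · exact h
    have hno : ∀ v w, Hears (layeredGraph l) tx v w → l w ≠ i := by
      intro v w hvw hw
      have hadj := hvw.2.1
      rw [layeredGraph_adj] at hadj
      have h3 := hvw.2.2.2 a (layeredGraph_adj.2 (by omega)) (hall w hw hvw.2.2.1 a ha)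
      have h4 := hvw.2.2.2 b (layeredGraph_adj.2 (by omega)) (hall w hw hvw.2.2.1 b hb)
      exact hab (h3.trans h4.symm)
    have hno' : ∀ v w, Hears (layeredGraph l') tx' v w → l' w ≠ i := by
      intro v w hvw hw
      have hadj := hvw.2.1
      rw [layeredGraph_adj] at hadj
      have hwt : tx w ≠ none := by rw [← heq w hw.le]; exact hvw.2.2.1
      have hwl : l w = i := (h1 w hw.le).trans hw
      have h3 := hvw.2.2.2 a (layeredGraph_adj.2 (by omega))
        (by rw [heq a ha'.le]; exact hall w hwl hwt a ha)
      have h4 := hvw.2.2.2 b (layeredGraph_adj.2 (by omega))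
        (by rw [heq b hb'.le]; exact hall w hwl hwt b hb)
      exact hab (h3.trans h4.symm)
    refine ⟨fun v hv => ?_, fun v hv => ?_, fun v hv => ?_⟩
    · rw [state_succ, state_succ, hst v hv]
      congr 1
      have hlv := h1 v hv
      refine received_congr (fun w => ⟨fun hw => ?_, fun hw => ?_⟩) fun w hw => ?_
      · have hne := hno' v w hw
        have hwl' := htl' w hw.2.2.1
        have hwl := h1 w hwl'
        have hadj := hw.2.1
        rw [layeredGraph_adj] at hadj
        refine ⟨by rw [← htx, ← heq v hv]; exact hw.1, layeredGraph_adj.2 (by omega),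
          by rw [← htx, ← heq w hwl']; exact hw.2.2.1, fun u hu hut => ?_⟩
        rw [layeredGraph_adj] at hu
        have hul := htl u hut
        rcases hul.eq_or_lt with h | h
        · exfalso
          have hat : tx' a ≠ none := by rw [heq a ha'.le]; exact hall u h hut a ha
          have := hw.2.2.2 a (layeredGraph_adj.2 (by omega)) hat
          exact hne (this ▸ ha')
        · have := h2 u h
          exact hw.2.2.2 u (layeredGraph_adj.2 (by omega)) (by
            rw [← htx', heq u (by omega)]; exact hut)
      · have hne := hno v w hw
        have hwl := htl w hw.2.2.1
        have hwl' := h2 w (by omega)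
        have hadj := hw.2.1
        rw [layeredGraph_adj] at hadj
        refine ⟨by rw [← htx', heq v hv]; exact hw.1, layeredGraph_adj.2 (by omega),
          by rw [← htx', heq w (by omega)]; exact hw.2.2.1, fun u hu hut => ?_⟩
        rw [layeredGraph_adj] at hu
        have hul' := htl' u hut
        have hul := h1 u hul'
        exact hw.2.2.2 u (layeredGraph_adj.2 (by omega)) (by
          rw [← htx, ← heq u hul']; exact hut)
      · exact heq w (htl' w hw.2.2.1)
    · refine A.asleep_succ (hsl' v hv) fun w hw => hno' v w hw ?_
      have := htl' w hw.2.2.1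
      have hadj := hw.2.1
      rw [layeredGraph_adj] at hadj
      omega
    · refine A.asleep_succ (hsl v hv) fun w hw => hno v w hw ?_
      have := htl w hw.2.2.1
      have hadj := hw.2.1
      rw [layeredGraph_adj] at hadj
      omega

theorem exists_pair_of_two_le_card [Fintype V] {p : V → Prop} [DecidablePred p]
    (h : 2 ≤ (Finset.univ.filter p).card) : ∃ a b, a ≠ b ∧ p a ∧ p b := by
  obtain ⟨a, ha, b, hb, hab⟩ := Finset.one_lt_card.1 h
  simp only [Finset.mem_filter, Finset.mem_univ, true_and] at ha hb
  exact ⟨a, b, hab, ha, hb⟩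

/-- Shrinking layer `i` to the larger half of its nodes that act in the same way extends the time
for which they are not told apart by one round; `2 ^ (j + 1)` nodes suffice for `j` rounds and a
final pair. -/
theorem AllOrNone.exists_refine [Fintype V] {i : ℕ} (j : ℕ) :
    ∀ {l : V → ℕ} {τ : ℕ}, A.AllOrNone lab S l i τ → 1 ≤ i → (∀ v ∈ S, l v = 0) →
      2 ^ (j + 1) ≤ (Finset.univ.filter fun v => l v = i).card →
      ∃ l' : V → ℕ, (∀ v, l' v ≤ i → l v = l' v) ∧ (∀ v, l v < i → l' v = l v) ∧
        (∀ v, i < l v → l' v = l v) ∧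
        (Finset.univ.filter fun v => l' v = i).card = 2 ∧ A.AllOrNone lab S l' i (τ + j) := by
  classical
  -- the layering in which layer `i` is cut down to `Q`
  have cut : ∀ {l : V → ℕ} {τ : ℕ}, A.AllOrNone lab S l i τ → 1 ≤ i → (∀ v ∈ S, l v = 0) →
      ∀ Q ⊆ (Finset.univ.filter fun v => l v = i), 2 ≤ Q.card →
      ∃ l' : V → ℕ, (∀ v, l' v ≤ i → l v = l' v) ∧ (∀ v, l v < i → l' v = l v) ∧
        (∀ v, i < l v → l' v = l v) ∧
        (Finset.univ.filter fun v => l' v = i) = Q ∧ (∀ v ∈ S, l' v = 0) ∧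
        (∀ v ∈ Q, ∀ t ≤ τ, A.state (layeredGraph l') lab S t v =
          A.state (layeredGraph l) lab S t v) := by
    intro l τ hA hi hS Q hQ hcard
    let l' : V → ℕ := fun v => if l v = i ∧ v ∉ Q then i + 1 else l v
    have hQl : ∀ v ∈ Q, l v = i := fun v hv => by simpa using hQ hv
    have hQl' : ∀ v ∈ Q, l' v = i := fun v hv => by simp [l', hv, hQl v hv]
    have h1 : ∀ v, l' v ≤ i → l v = l' v := fun v hv => by
      simp only [l'] at hv ⊢; split_ifs at hv ⊢ <;> omega
    have h2 : ∀ v, l v < i → l' v = l v := fun v hv => by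
      simp only [l']; split_ifs <;> omega
    have hS' : ∀ v ∈ S, l' v = 0 := fun v hv => by
      rw [h2 v (by have := hS v hv; omega), hS v hv]
    have hfil : (Finset.univ.filter fun v => l' v = i) = Q := by
      ext v
      simp only [Finset.mem_filter, Finset.mem_univ, true_and]
      refine ⟨fun h => ?_, hQl' v⟩
      by_contra hv
      have := h1 v h.le
      simp [l', hv, this.trans h] at h
    refine ⟨l', h1, h2, fun v hv => ?_, hfil, hS', fun v hv t ht => ?_⟩
    · simp only [l']; split_ifs <;> omega
    · exact (hA.state_agree hS' h1 h2
        (exists_pair_of_two_le_card (by rw [hfil]; exact hcard)) t ht).1 v (hQl' v hv).le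
  have extend : ∀ {l l' : V → ℕ} {τ : ℕ} {Q : Finset V}, A.AllOrNone lab S l i τ →
      Q ⊆ (Finset.univ.filter fun v => l v = i) →
      (Finset.univ.filter fun v => l' v = i) = Q →
      (∀ v ∈ Q, ∀ t ≤ τ, A.state (layeredGraph l') lab S t v =
          A.state (layeredGraph l) lab S t v) → A.AllOrNone lab S l' i τ := by
    intro l l' τ Q hA hQ hfil hst t ht
    have hmem : ∀ v, l' v = i → v ∈ Q := fun v hv => by rw [← hfil]; simpa using hv
    have hQl : ∀ v ∈ Q, l v = i := fun v hv => by simpa using hQ hv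
    refine (hA t ht).imp (fun h v hv => ?_) (fun h v hv => ?_)
    · rw [← h v (hQl v (hmem v hv)), transmits, transmits, hst v (hmem v hv) t ht.le]
    · have := h v (hQl v (hmem v hv))
      rwa [transmits, ← hst v (hmem v hv) t ht.le] at this
  induction j with
  | zero =>
    intro l τ hA hi hS hcard
    obtain ⟨Q, hQ, hQc⟩ := Finset.exists_subset_card_eq (by simpa using hcard)
    obtain ⟨l', h1, h2, h3, hfil, -, hst⟩ := cut hA hi hS Q hQ hQc.ge
    exact ⟨l', h1, h2, h3, by rw [hfil, hQc], extend hA hQ hfil hst⟩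
  | succ j ih =>
    intro l τ hA hi hS hcard
    set L := Finset.univ.filter fun v => l v = i with hL
    let tx := A.transmits (layeredGraph l) lab S τ
    have hsum := Finset.card_filter_add_card_filter_not (s := L) (fun v => tx v = none)
    obtain ⟨Q, hQ, hQc, hQt⟩ : ∃ Q ⊆ L, 2 ^ (j + 1) ≤ Q.card ∧
        ((∀ v ∈ Q, tx v = none) ∨ ∀ v ∈ Q, tx v ≠ none) := by
      rw [pow_succ] at hcard
      by_cases h : 2 ^ (j + 1) ≤ (L.filter fun v => tx v = none).card
      · exact ⟨_, Finset.filter_subset _ _, h, .inl fun v hv => (Finset.mem_filter.1 hv).2⟩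
      · exact ⟨L.filter fun v => ¬ tx v = none, Finset.filter_subset _ _, by omega,
          .inr fun v hv => (Finset.mem_filter.1 hv).2⟩
    have hQ2 : 2 ≤ Q.card := by
      have := Nat.one_le_two_pow (n := j)
      rw [pow_succ] at hQc
      omega
    obtain ⟨l1, h1, h2, h3, hfil, hS1, hst⟩ := cut hA hi hS Q hQ hQ2
    have hA1 : A.AllOrNone lab S l1 i (τ + 1) := by
      intro t ht
      rcases (Nat.lt_succ_iff.1 ht).lt_or_eq with h | h
      · exact extend hA hQ hfil hst t h
      · subst h
        have hmem : ∀ v, l1 v = i → v ∈ Q := fun v hv => by rw [← hfil]; simpa using hv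
        have htx : ∀ v ∈ Q, A.transmits (layeredGraph l1) lab S t v = tx v := fun v hv => by
          simp only [tx, transmits, hst v hv t le_rfl]
        exact hQt.imp (fun h v hv => by rw [htx v (hmem v hv)]; exact h v (hmem v hv))
          (fun h v hv => by rw [htx v (hmem v hv)]; exact h v (hmem v hv))
    obtain ⟨l', g1, g2, g3, hc, hA'⟩ := ih hA1 hi hS1 (by rw [hfil]; exact hQc)
    refine ⟨l', fun v hv => ?_, fun v hv => ?_, fun v hv => ?_, hc, ?_⟩
    · have := g1 v hv
      rw [h1 v (by omega), this]
    · rw [g2 v (by rw [h2 v hv]; exact hv), h2 v hv]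
    · rw [g3 v (by rw [h3 v hv]; exact hv), h3 v hv]
    · rwa [show τ + (j + 1) = τ + 1 + j by omega]

/-- The sources form layer `0`, and each of the layers `1, …, i` consists of two nodes, chosen such
that each of them delays the wake-up of the next layer by `w` rounds, whatever the
other nodes do. -/
theorem exists_slow_layers [Fintype V] (A : RadioAlgorithm Λ) (lab : V → Λ) {S : Finset V}
    (hne : S.Nonempty) {z : V} (hz : z ∉ S) {w h : ℕ} (hw : 1 ≤ w)
    (hcard : S.card + 1 + 2 * (h - 1) + 2 ^ w ≤ Fintype.card V) {i : ℕ} (hi : i ≤ h) :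
    ∃ l : V → ℕ, (∀ v, l v = 0 ↔ v ∈ S) ∧ i < l z ∧
      (Finset.univ.filter fun v => l v ≤ i).card = S.card + 2 * i ∧
      (∀ j ≤ i, ∃ v, l v = j) ∧
      ∀ l' : V → ℕ, (∀ v, l' v ≤ i → l v = l' v) → (∀ v, l v ≤ i → l' v = l v) →
        ∀ t ≤ i * w, ∀ v, i < l' v → A.state (layeredGraph l') lab S t v = none := by
  classical
  induction i with
  | zero =>
    refine ⟨fun v => if v ∈ S then 0 else 1, fun v => by simp, by simp [hz], ?_, ?_, ?_⟩
    · rw [Finset.filter_congr (q := (· ∈ S)) (fun v _ => by by_cases h : v ∈ S <;> simp [h])]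
      simp
    · intro j hj
      obtain ⟨v, hv⟩ := hne
      exact ⟨v, by simp [hv]; omega⟩
    · intro l' h1 h2 t ht v hv
      obtain rfl : t = 0 := by omega
      refine A.state_zero_of_notMem _ _ _ fun hvS => ?_
      have := h2 v (by simp [hvS])
      simp [hvS] at this
      omega
  | succ i ih =>
    obtain ⟨l, hl0, hlz, hlc, hls, hsleep⟩ := ih (by omega)
    -- all nodes that are still free, except the sink, are candidates for layer `i + 1`
    let lp : V → ℕ := fun v => if l v ≤ i then l v else if v = z then i + 2 else i + 1
    have p1 : ∀ v, lp v ≤ i → l v = lp v := fun v hv => by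
      simp only [lp] at hv ⊢; split_ifs at hv ⊢ <;> omega
    have p2 : ∀ v, l v ≤ i → lp v = l v := fun v hv => by simp [lp, hv]
    have pz : lp z = i + 2 := by simp [lp, hlz]
    have hSp : ∀ v ∈ S, lp v = 0 := fun v hv => by
      have := (hl0 v).2 hv
      rw [p2 v (by omega), this]
    have hAp : A.AllOrNone lab S lp (i + 1) (i * w + 1) := fun t ht => .inl fun v hv =>
      A.transmits_eq_none_of_asleep (hsleep lp p1 p2 t (by omega) v (by omega))
    have hpool : (Finset.univ.filter fun v => lp v = i + 1).card + (S.card + 2 * i) + 1 =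
        Fintype.card V := by
      have hun : (Finset.univ : Finset V) = insert z
          ((Finset.univ.filter fun v => lp v = i + 1) ∪ (Finset.univ.filter fun v => l v ≤ i)) := by
        ext v
        simp only [Finset.mem_univ, Finset.mem_insert, Finset.mem_union, Finset.mem_filter,
          true_and, true_iff, lp]
        by_cases h1 : v = z <;> by_cases h2 : l v ≤ i <;> simp [h1, h2]
      have hc := congrArg Finset.card hun
      rw [Finset.card_insert_of_notMem (by simp [pz, hlz]), Finset.card_union_of_disjoint, hlc,
        Finset.card_univ] at hc
      · exact hc.symm
      · rw [Finset.disjoint_left]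
        intro v hv hv'
        simp only [Finset.mem_filter, Finset.mem_univ, true_and] at hv hv'
        have := p2 v hv'
        omega
    obtain ⟨l1, g1, g2, g3, gc, gA⟩ := hAp.exists_refine (w - 1) (by omega) hSp (by
      rw [show w - 1 + 1 = w by omega]
      omega)
    have k1 : ∀ v, l1 v ≤ i → l v = l1 v := fun v hv => by
      have := g1 v (by omega)
      rw [← this]; exact p1 v (by omega)
    have k2 : ∀ v, l v ≤ i → l1 v = l v := fun v hv => by
      have := p2 v hv
      rw [g2 v (by omega), this]
    refine ⟨l1, fun v => ?_, ?_, ?_, fun j hj => ?_, fun l' e1 e2 t ht v hv => ?_⟩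
    · rw [← hl0]
      constructor
      · intro hv; rw [k1 v (by omega), hv]
      · intro hv; rw [k2 v (by omega), hv]
    · rw [g3 z (by omega)]; omega
    · have hun : (Finset.univ.filter fun v => l1 v ≤ i + 1) =
          (Finset.univ.filter fun v => l1 v = i + 1) ∪ (Finset.univ.filter fun v => l v ≤ i) := by
        ext v
        simp only [Finset.mem_union, Finset.mem_filter, Finset.mem_univ, true_and]
        constructor
        · intro hv
          rcases hv.eq_or_lt with h | h
          · exact .inl h
          · right; rw [k1 v (by omega)]; omega
        · rintro (hv | hv)
          · omega
          · rw [k2 v hv]; omega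
      rw [hun, Finset.card_union_of_disjoint, hlc, gc]
      · omega
      · rw [Finset.disjoint_left]
        intro v hv hv'
        simp only [Finset.mem_filter, Finset.mem_univ, true_and] at hv hv'
        have := k2 v hv'
        omega
    · rcases hj.eq_or_lt with h | h
      · obtain ⟨a, b, -, ha, -⟩ := exists_pair_of_two_le_card gc.ge
        exact ⟨a, by rw [ha, h]⟩
      · obtain ⟨v, hv⟩ := hls j (by omega)
        exact ⟨v, by rw [k2 v (by omega), hv]⟩
    · obtain ⟨a, b, hab, ha, hb⟩ := exists_pair_of_two_le_card gc.ge
      refine (gA.state_agree (l' := l') (fun v hv => ?_) e1 (fun v hv => e2 v (by omega))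
        ⟨a, b, hab, by rw [e2 a (by omega), ha], by rw [e2 b (by omega), hb]⟩ t ?_).2.1 v hv
      · have h0 := (hl0 v).2 hv
        have := k2 v (by omega)
        rw [e2 v (by omega)]; omega
      · rw [show i * w + 1 + (w - 1) = i * w + w by omega, ← Nat.succ_mul]
        exact ht

end RadioAlgorithm

/-! ### Sets of prescribed size that no query isolates -/

open Finset in
/-- A strengthening of the lower bound for selective families to sets of size exactly `k`. Among the
`r`-subsets of `P` that have the same parities as a fixed one, `R₀`, many have a symmetric
difference with `R₀` that meets the same queries. Such a difference `T` meets each of these queries in an even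
number of elements, so at least twice, and it can be enlarged by elements of the other
differences, because they belong to no further queries. -/
theorem exists_unselected {α : Type*} [DecidableEq α] (P : Finset α) (m r k : ℕ)
    (F : ℕ → α → Prop) (hr : 2 * r ≤ k) (h : 4 ^ m * 2 ^ (r + k) ≤ P.card.choose r) :
    ∃ S ⊆ P, S.card = k ∧ ∀ j < m, ¬ ∃! x, x ∈ S ∧ F j x := by
  classical
  let par : Finset α → Fin m → Bool := fun R j => decide (Even (R.filter (F j)).card)
  have hsig : (univ : Finset (Fin m → Bool)).card = 2 ^ m := by simp
  obtain ⟨y, -, hy⟩ := exists_le_card_fiber_of_mul_le_card_of_maps_to (s := P.powersetCard r)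
    (t := univ) (f := par) (n := 2 ^ m * 2 ^ (r + k)) (fun _ _ => mem_univ _) univ_nonempty (by
      rw [hsig, card_powersetCard, ← mul_assoc, ← mul_pow]; exact h)
  set C := (P.powersetCard r).filter fun R => par R = y with hC
  have hCpos : 0 < C.card := lt_of_lt_of_le (by positivity) hy
  obtain ⟨R₀, hR₀⟩ := card_pos.1 hCpos
  let U : Finset α → Fin m → Bool := fun R j => decide (∃ x ∈ symmDiff R₀ R, F j x)
  obtain ⟨u, -, hu⟩ := exists_le_card_fiber_of_mul_le_card_of_maps_to (s := C)
    (t := univ) (f := U) (n := 2 ^ (r + k)) (fun _ _ => mem_univ _) univ_nonempty (by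
      rw [hsig]; exact hy)
  set C' := C.filter fun R => U R = u with hC'
  have hC'pos : 0 < C'.card := lt_of_lt_of_le (by positivity) hu
  obtain ⟨R₁, hR₁⟩ := card_pos.1 hC'pos
  have hCmem : ∀ R ∈ C, R ⊆ P ∧ R.card = r ∧ par R = y := fun R hR => by
    obtain ⟨h1, h2⟩ := mem_filter.1 hR
    exact ⟨(mem_powersetCard.1 h1).1, (mem_powersetCard.1 h1).2, h2⟩
  have hC'mem : ∀ R ∈ C', R ∈ C ∧ U R = u := fun R hR => mem_filter.1 hR
  obtain ⟨h0P, h0c, h0y⟩ := hCmem R₀ hR₀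
  obtain ⟨h1P, h1c, h1y⟩ := hCmem R₁ (hC'mem R₁ hR₁).1
  let W := C'.biUnion fun R => symmDiff R₀ R
  have hWP : W ⊆ P := by
    intro x hx
    obtain ⟨R, hR, hxR⟩ := mem_biUnion.1 hx
    rcases mem_symmDiff.1 hxR with h | h
    · exact h0P h.1
    · exact (hCmem R (hC'mem R hR).1).1 h.1
  have hWk : k ≤ W.card := by
    have hsub : C' ⊆ (W ∪ R₀).powerset := by
      intro R hR
      rw [mem_powerset]
      intro x hx
      by_cases hx0 : x ∈ R₀
      · exact mem_union_right _ hx0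
      · exact mem_union_left _ (mem_biUnion.2 ⟨R, hR, mem_symmDiff.2 (.inr ⟨hx, hx0⟩)⟩)
    have h2 := hu.trans (card_le_card hsub)
    rw [card_powerset] at h2
    have h3 := (Nat.pow_le_pow_iff_right (by norm_num)).1 h2
    have h4 := card_union_le W R₀
    omega
  have hTW : symmDiff R₀ R₁ ⊆ W := fun x hx => mem_biUnion.2 ⟨R₁, hR₁, hx⟩
  have hTk : (symmDiff R₀ R₁).card ≤ k := by
    have : (symmDiff R₀ R₁).card ≤ (R₀ ∪ R₁).card := card_le_card (symmDiff_le_sup)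
    have := card_union_le R₀ R₁
    omega
  obtain ⟨S, hTS, hSW, hSk⟩ := exists_subsuperset_card_eq hTW hTk hWk
  refine ⟨S, hSW.trans hWP, hSk, fun j hj => ?_⟩
  rintro ⟨x, ⟨hxS, hxF⟩, huniq⟩
  -- `x` lies in some difference, which meets the same queries as `T`
  obtain ⟨R, hR, hxR⟩ := mem_biUnion.1 (hSW hxS)
  have hUR : U R ⟨j, hj⟩ = U R₁ ⟨j, hj⟩ := by rw [(hC'mem R hR).2, (hC'mem R₁ hR₁).2]
  have hT : ∃ x ∈ symmDiff R₀ R₁, F j x := by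
    have h1 : U R ⟨j, hj⟩ = true := decide_eq_true ⟨x, hxR, hxF⟩
    rw [hUR] at h1
    exact of_decide_eq_true h1
  have heven : Even ((symmDiff R₀ R₁).filter (F j)).card := by
    have hpar : par R₀ ⟨j, hj⟩ = par R₁ ⟨j, hj⟩ := by rw [h0y, h1y]
    have hpar' : Even (R₀.filter (F j)).card ↔ Even (R₁.filter (F j)).card := by
      simpa [par] using hpar
    have hsd : (symmDiff R₀ R₁).filter (F j) =
        (R₀.filter (F j) \ R₁.filter (F j)) ∪ (R₁.filter (F j) \ R₀.filter (F j)) := by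
      ext x
      simp only [mem_filter, mem_symmDiff, mem_union, mem_sdiff]
      tauto
    rw [hsd, card_union_of_disjoint disjoint_sdiff_sdiff]
    have e1 := card_sdiff_add_card_inter (R₀.filter (F j)) (R₁.filter (F j))
    have e2 := card_sdiff_add_card_inter (R₁.filter (F j)) (R₀.filter (F j))
    rw [inter_comm] at e2
    rw [Nat.even_iff, Nat.even_iff] at hpar'
    rw [Nat.even_iff]
    omega
  obtain ⟨x', hx', hx'F⟩ := hT
  have hpos : 0 < ((symmDiff R₀ R₁).filter (F j)).card :=
    card_pos.2 ⟨x', mem_filter.2 ⟨hx', hx'F⟩⟩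
  have h2 : 1 < ((symmDiff R₀ R₁).filter (F j)).card := by
    rw [Nat.even_iff] at heven; omega
  obtain ⟨a, ha, b, hb, hab⟩ := one_lt_card.1 h2
  rw [mem_filter] at ha hb
  exact hab ((huniq a ⟨hTS ha.1, ha.2⟩).trans (huniq b ⟨hTS hb.1, hb.2⟩).symm)

/-! ### Lower bounds in layered networks -/

/-- Enough nodes can be distributed over the layers `a + 1, …, D` such that none is empty. -/
theorem exists_onto_layers {V : Type} (R : Finset V) {a D : ℕ} (haD : a < D)
    (hR : D - a ≤ R.card) :
    ∃ f : V → ℕ, (∀ v, a < f v ∧ f v ≤ D) ∧ ∀ i, a < i → i ≤ D → ∃ v ∈ R, f v = i := by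
  classical
  let e := R.equivFin
  refine ⟨fun v => if h : v ∈ R then a + 1 + min (e ⟨v, h⟩ : ℕ) (D - a - 1) else D,
    fun v => ?_, fun i hi hiD => ?_⟩
  · dsimp only
    split_ifs <;> omega
  · let x := e.symm ⟨i - a - 1, by omega⟩
    refine ⟨x, x.2, ?_⟩
    have : (e ⟨x, x.2⟩ : ℕ) = i - a - 1 := by simp [x]
    dsimp only
    rw [dif_pos x.2, this]
    omega

/-- A layered network as an instance for a lower bound; the node `v` has the ID `v + 1`. -/
theorem requiresRounds_of_layers {n D k : ℕ} (A : RadioAlgorithm (ℕ × Bool)) {b : ℝ} (hD : 2 ≤ D)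
    {l : Fin n → ℕ} (hle : ∀ v, l v ≤ D) (hsurj : ∀ i ≤ D, ∃ v, l v = i) {S : Finset (Fin n)}
    (hS : S.card = k) (z : Fin n)
    (h : ∀ T, (∀ u ∈ S, u ∈ A.known (layeredGraph l) (fun v => ((v : ℕ) + 1, decide (v = z))) S T z) →
      b ≤ (T : ℝ)) :
    RequiresRounds n D k A b :=
  ⟨⟨layeredGraph l, layeredGraph_connected hD hsurj hle, layeredGraph_diam hD hsurj hle, S, hS, z⟩,
    fun v => (v : ℕ) + 1,
    ⟨fun _ _ huv => Fin.ext (by simpa using huv), fun v => ⟨Nat.succ_pos _, v.2⟩⟩, h⟩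

theorem RequiresRounds.mono {n D k : ℕ} {A : RadioAlgorithm (ℕ × Bool)} {b b' : ℝ}
    (h : RequiresRounds n D k A b) (hb : b' ≤ b) : RequiresRounds n D k A b' := by
  obtain ⟨I, ident, hid, hT⟩ := h
  exact ⟨I, ident, hid, fun T hs => hb.trans (hT T hs)⟩

/-- The lower bound `Ω(D log (n - k))`, from a chain of layers each of which delays the wake-up of
the next one. -/
theorem requiresRounds_chain {n D k : ℕ} (hD : 2 ≤ D) (hk : 1 ≤ k) (hn : 2 * D + k ≤ n + 1)
    (A : RadioAlgorithm (ℕ × Bool)) {w : ℕ} (hw : 1 ≤ w) (hwn : 2 ^ w ≤ (n - k - 1) / 2 + 1) :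
    RequiresRounds n D k A (((D / 2 * w : ℕ) : ℝ)) := by
  classical
  let z : Fin n := ⟨n - 1, by omega⟩
  obtain ⟨S, hSsub, hSc⟩ := Finset.exists_subset_card_eq
    (s := (Finset.univ.erase z : Finset (Fin n))) (n := k) (by
      rw [Finset.card_erase_of_mem (Finset.mem_univ _), Finset.card_univ, Fintype.card_fin]; omega)
  have hz : z ∉ S := fun h => by simpa using hSsub h
  obtain ⟨l, hl0, hlz, hlc, hls, hsleep⟩ := RadioAlgorithm.exists_slow_layers A
    (fun v : Fin n => ((v : ℕ) + 1, decide (v = z))) (S := S) (Finset.card_pos.1 (by omega)) hz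
    (w := w) (h := D / 2) hw (by rw [hSc, Fintype.card_fin]; omega) le_rfl
  obtain ⟨f, hf, hfs⟩ := exists_onto_layers (Finset.univ.filter fun v => ¬ l v ≤ D / 2)
    (a := D / 2) (D := D) (by omega) (by
      have := Finset.card_filter_add_card_filter_not (s := (Finset.univ : Finset (Fin n)))
        (fun v => l v ≤ D / 2)
      rw [Finset.card_univ, Fintype.card_fin] at this
      omega)
  let l' : Fin n → ℕ := fun v => if l v ≤ D / 2 then l v else f v
  have e1 : ∀ v, l' v ≤ D / 2 → l v = l' v := fun v hv => by
    have := hf v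
    simp only [l'] at hv ⊢; split_ifs at hv ⊢ <;> omega
  have e2 : ∀ v, l v ≤ D / 2 → l' v = l v := fun v hv => by simp [l', hv]
  have ez : D / 2 < l' z := by
    have := hf z
    simp only [l']; split_ifs <;> omega
  refine requiresRounds_of_layers A hD (l := l') (fun v => ?_) (fun i hi => ?_) hSc z fun T hT => ?_
  · have := hf v
    simp only [l']; split_ifs <;> omega
  · by_cases h : i ≤ D / 2
    · obtain ⟨v, hv⟩ := hls i h
      exact ⟨v, by rw [e2 v (by omega), hv]⟩
    · obtain ⟨v, hv, hvi⟩ := hfs i (by omega) hi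
      exact ⟨v, by simp only [l']; rw [if_neg (by simpa using hv), hvi]⟩
  · obtain ⟨u, hu⟩ := Finset.card_pos.1 (by omega : 0 < S.card)
    have hne := A.state_ne_none_of_mem_known (hT u hu)
    by_contra hlt
    have hTle : T ≤ D / 2 * w := by exact_mod_cast (not_le.1 hlt).le
    exact hne (hsleep l' e1 e2 T hTle z ez)

/-- The sources in layer `0`, the sink `z` alone in layer `1`, the other nodes in further layers. -/
theorem exists_star_layers {n D k : ℕ} (hD : 2 ≤ D) (hk : 1 ≤ k) (hn : D + k ≤ n)
    {S : Finset (Fin n)} (hSc : S.card = k) {z : Fin n} (hz : z ∉ S) :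
    ∃ l : Fin n → ℕ, (∀ v, l v ≤ D) ∧ (∀ i ≤ D, ∃ v, l v = i) ∧ (∀ v, l v = 0 ↔ v ∈ S) ∧
      ∀ v, l v = 1 ↔ v = z := by
  classical
  obtain ⟨f, hf, hfs⟩ := exists_onto_layers (Finset.univ \ insert z S)
    (a := 1) (D := D) (by omega) (by
      rw [Finset.card_sdiff_of_subset (Finset.subset_univ _), Finset.card_univ, Fintype.card_fin,
        Finset.card_insert_of_notMem hz]
      omega)
  refine ⟨fun v => if v ∈ S then 0 else if v = z then 1 else f v, fun v => ?_, fun i hi => ?_,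
    fun v => ?_, fun v => ?_⟩
  · have := hf v
    dsimp only; split_ifs <;> omega
  · rcases Nat.lt_or_ge 1 i with h | h
    · obtain ⟨v, hv, hvi⟩ := hfs i h hi
      simp only [Finset.mem_sdiff, Finset.mem_univ, Finset.mem_insert, not_or, true_and] at hv
      exact ⟨v, by simp [hv.1, hv.2, hvi]⟩
    · interval_cases i
      · obtain ⟨v, hv⟩ := Finset.card_pos.1 (by omega : 0 < S.card)
        exact ⟨v, by simp [hv]⟩
      · exact ⟨z, by simp [hz]⟩
  · have := hf v
    dsimp only
    split_ifs with h1 h2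
    · simp [h1]
    · simp [h1]
    · simp only [h1, iff_false]; omega
  · have := hf v
    dsimp only
    split_ifs with h1 h2
    · simp only [false_iff]
      rintro rfl; exact hz h1
    · simp [h2]
    · simp only [h2, iff_false]; omega

/-- At most one message per round reaches the sink if all sources are attached to it. -/
theorem requiresRounds_sources {n D k : ℕ} (hD : 2 ≤ D) (hk : 1 ≤ k) (hn : 2 * D + k ≤ n + 1)
    (A : RadioAlgorithm (ℕ × Bool)) : RequiresRounds n D k A (k : ℝ) := by
  classical
  let z : Fin n := ⟨n - 1, by omega⟩
  obtain ⟨S, hSsub, hSc⟩ := Finset.exists_subset_card_eq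
    (s := (Finset.univ.erase z : Finset (Fin n))) (n := k) (by
      rw [Finset.card_erase_of_mem (Finset.mem_univ _), Finset.card_univ, Fintype.card_fin]; omega)
  have hz : z ∉ S := fun h => by simpa using hSsub h
  obtain ⟨l, hle, hsurj, hl0, hl1⟩ := exists_star_layers hD hk (by omega) hSc hz
  refine requiresRounds_of_layers A hD hle hsurj hSc z fun T hT => ?_
  set kn := A.known (layeredGraph l) (fun v => ((v : ℕ) + 1, decide (v = z))) S with hkn
  -- a node knows at most its own message and those that the sink knows
  have key : ∀ t, (∀ v, kn t v ⊆ insert v (kn t z)) ∧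
      ∃ B : Finset (Fin n), B.card ≤ t ∧ kn t z ⊆ B := by
    intro t
    induction t with
    | zero =>
      refine ⟨fun v u hu => ?_, ∅, le_rfl, fun u hu => ?_⟩
      · exact .inl hu.2
      · exact absurd (hu.2 ▸ hu.1) hz
    | succ t ih =>
      obtain ⟨ih1, B, hB, hBz⟩ := ih
      have hmono : kn t z ⊆ kn (t + 1) z := Set.subset_union_left
      constructor
      · rintro v u (hu | ⟨w, hw, hu⟩)
        · exact Set.insert_subset_insert hmono (ih1 v hu)
        · rcases ih1 w hu with rfl | hu
          · by_cases hv : v = z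
            · subst hv
              exact .inr (.inr ⟨u, hw, hu⟩)
            · -- a source has no neighbour but the sink
              have := hw.2.1
              rw [layeredGraph_adj, (hl0 u).2 (A.mem_sources_of_mem_known hu)] at this
              exact absurd ((hl1 v).1 (by omega)) hv
          · exact .inr (hmono hu)
      · by_cases hex : ∃ w, Hears (layeredGraph l)
            (A.transmits (layeredGraph l) (fun v => ((v : ℕ) + 1, decide (v = z))) S t) z w
        · obtain ⟨w, hw⟩ := hex
          refine ⟨insert w B, (Finset.card_insert_le _ _).trans (by omega), ?_⟩
          rw [Finset.coe_insert]
          rintro u (hu | ⟨w', hw', hu⟩)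
          · exact .inr (hBz hu)
          · rw [hw'.unique hw] at hu
            exact Set.insert_subset_insert hBz (ih1 w hu)
        · refine ⟨B, by omega, ?_⟩
          rintro u (hu | ⟨w', hw', hu⟩)
          · exact hBz hu
          · exact absurd ⟨w', hw'⟩ hex
  obtain ⟨B, hB, hBz⟩ := (key T).2
  have hSB : S ⊆ B := fun u hu => hBz (hT u hu)
  have := Finset.card_le_card hSB
  exact_mod_cast (by omega : k ≤ T)

/-- The first message reaches the sink only in a round in which exactly one source transmits. -/
theorem requiresRounds_unselected {n D k r m : ℕ} (hD : 2 ≤ D) (hk : 1 ≤ k)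
    (hn : 2 * D + k ≤ n + 1) (A : RadioAlgorithm (ℕ × Bool)) (hr : 2 * r ≤ k)
    (hm : 4 ^ m * 2 ^ (r + k) ≤ (n - 1).choose r) :
    RequiresRounds n D k A ((m + 1 : ℕ) : ℝ) := by
  classical
  let z : Fin n := ⟨n - 1, by omega⟩
  let lab : Fin n → ℕ × Bool := fun v => ((v : ℕ) + 1, decide (v = z))
  -- the states of a source that has not heard anything
  let q : ℕ → Fin n → A.State := fun t v => (fun s => A.step s none)^[t] (A.start (lab v))
  obtain ⟨S, hSsub, hSc, hSF⟩ := exists_unselected (Finset.univ.erase z : Finset (Fin n)) m r k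
    (fun t v => A.send (q t v) ≠ none) hr (by
      rw [Finset.card_erase_of_mem (Finset.mem_univ _), Finset.card_univ, Fintype.card_fin]
      exact hm)
  have hz : z ∉ S := fun h => by simpa using hSsub h
  obtain ⟨l, hle, hsurj, hl0, hl1⟩ := exists_star_layers hD hk (by omega) hSc hz
  refine requiresRounds_of_layers A hD hle hsurj hSc z fun T hT => ?_
  have key : ∀ t ≤ m, (∀ v ∈ S, A.state (layeredGraph l) lab S t v = some (q t v)) ∧
      ∀ v, v ∉ S → A.state (layeredGraph l) lab S t v = none := by
    intro t
    induction t with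
    | zero =>
      exact fun _ => ⟨fun v hv => A.state_zero_of_mem _ _ _ hv,
        fun v hv => A.state_zero_of_notMem _ _ _ hv⟩
    | succ t ih =>
      intro ht
      obtain ⟨ihS, ihn⟩ := ih (by omega)
      have htS : ∀ v, A.transmits (layeredGraph l) lab S t v ≠ none → v ∈ S := fun v hv => by
        by_contra h
        exact hv (A.transmits_eq_none_of_asleep (ihn v h))
      have hno : ∀ v w, ¬ Hears (layeredGraph l) (A.transmits (layeredGraph l) lab S t) v w := by
        intro v w hvw
        have hwS := htS w hvw.2.2.1
        have hadj := hvw.2.1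
        rw [layeredGraph_adj, (hl0 w).2 hwS] at hadj
        -- whoever hears `w` is the sink, which is adjacent to all sources
        have hsend : ∀ u ∈ S, A.transmits (layeredGraph l) lab S t u = A.send (q t u) :=
          fun u hu => A.transmits_of_state_eq (ihS u hu)
        refine hSF t (by omega) ⟨w, ⟨hwS, ?_⟩, fun u hu => ?_⟩
        · rw [← hsend w hwS]; exact hvw.2.2.1
        · refine hvw.2.2.2 u ?_ ?_
          · rw [layeredGraph_adj, (hl0 u).2 hu.1]; omega
          · rw [hsend u hu.1]; exact hu.2
      refine ⟨fun v hv => ?_, fun v hv => A.asleep_succ (ihn v hv) (hno v)⟩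
      rw [A.state_succ, ihS v hv, received_eq_none (hno v)]
      simp only [RadioAlgorithm.next, q, Function.iterate_succ_apply']
  obtain ⟨u, hu⟩ := Finset.card_pos.1 (by omega : 0 < S.card)
  have hne := A.state_ne_none_of_mem_known (hT u hu)
  by_contra hlt
  have hTm : T < m + 1 := by exact_mod_cast not_le.1 hlt
  exact hne ((key T (by omega)).2 z hz)

/-! ### The lower bounds in closed form -/

open Real in
theorem requiresRounds_mul_log {n D k : ℕ} (hD : 2 ≤ D) (hk : 1 ≤ k) (hn : 2 * D + k ≤ n + 1)
    (A : RadioAlgorithm (ℕ × Bool)) : RequiresRounds n D k A ((D : ℝ) * logb 2 n / 18) := by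
  set M := n - k - 1 with hM
  have hn4 : 4 ≤ n := by omega
  rcases le_or_gt n (M * M) with hMn | hMn
  · set w := Nat.log 2 (M / 2 + 1) with hw
    have hw1 : 1 ≤ w := Nat.log_pos (by norm_num) (by omega)
    have hlt : M / 2 + 1 < 2 ^ (w + 1) := Nat.lt_pow_succ_log_self (by norm_num) _
    refine (requiresRounds_chain hD hk hn A hw1
      (Nat.pow_log_le_self 2 (by omega))).mono ?_
    have hn' : (n : ℝ) ≤ 2 ^ (2 * w + 4 : ℕ) := by
      have h1 : M ≤ 2 ^ (w + 2) := by rw [pow_succ]; omega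
      have h2 : n ≤ 2 ^ (2 * w + 4) :=
        hMn.trans ((Nat.mul_le_mul h1 h1).trans_eq (by rw [← pow_add]; ring_nf))
      exact_mod_cast h2
    have hlog : logb 2 n ≤ 6 * w := by
      have h1 : logb 2 n ≤ logb 2 (2 ^ (2 * w + 4 : ℕ)) :=
        logb_le_logb_of_le (by norm_num) (by positivity) hn'
      rw [logb_pow, logb_self_eq_one (by norm_num)] at h1
      push_cast at h1
      have : (1 : ℝ) ≤ w := by exact_mod_cast hw1
      linarith
    have hD3 : (D : ℝ) ≤ 3 * (D / 2 : ℕ) := by exact_mod_cast (by omega : D ≤ 3 * (D / 2))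
    push_cast
    have := mul_le_mul hD3 hlog (logb_nonneg (by norm_num) (by exact_mod_cast (by omega : 1 ≤ n)))
      (by positivity)
    linarith
  · -- here `k ≥ n / 4`, and `D log n ≤ √n log n = O(n)`
    refine (requiresRounds_sources hD hk hn A).mono ?_
    have h4k : n ≤ 4 * k := by
      have h2 : 2 ≤ M := by omega
      have h3 : n = M + k + 1 := by omega
      nlinarith
    set s := √(n : ℝ) with hs
    have hss : s * s = n := mul_self_sqrt (by positivity)
    have hs1 : 0 < s := sqrt_pos.2 (by exact_mod_cast (by omega : 0 < n))
    have hDs : (D : ℝ) ≤ s := by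
      rw [hs]
      apply le_sqrt_of_sq_le
      have : D * D ≤ M * M := Nat.mul_le_mul (by omega) (by omega)
      exact_mod_cast (by rw [sq]; omega : D ^ 2 ≤ n)
    have hlog : logb 2 n ≤ 3 * s := by
      rw [← hss, logb, log_mul hs1.ne' hs1.ne', div_le_iff₀ (log_pos (by norm_num))]
      have h1 := log_le_sub_one_of_pos hs1
      have h2 := log_two_gt_d9
      nlinarith
    have := mul_le_mul hDs hlog (logb_nonneg (by norm_num) (by exact_mod_cast (by omega : 1 ≤ n)))
      hs1.le
    have h4k' : (n : ℝ) ≤ 4 * k := by exact_mod_cast h4k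
    nlinarith

open Real in
theorem requiresRounds_mul_log_div {n D k : ℕ} (hD : 2 ≤ D) (hk : 1 ≤ k)
    (hn : 2 * D + k ≤ n + 1) (A : RadioAlgorithm (ℕ × Bool)) :
    RequiresRounds n D k A ((k : ℝ) * logb 2 ((n : ℝ) / k) / 36) := by
  have hn0 : (0 : ℝ) < n := by exact_mod_cast (by omega : 0 < n)
  have hk0 : (0 : ℝ) < k := by exact_mod_cast hk
  set L := logb 2 ((n : ℝ) / k) with hL
  have hL0 : 0 ≤ L := by
    apply logb_nonneg (by norm_num)
    rw [one_le_div hk0]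
    exact_mod_cast (by omega : k ≤ n)
  rcases hk.eq_or_lt with rfl | hk2
  · refine (requiresRounds_mul_log hD hk hn A).mono ?_
    have h2 : (2 : ℝ) ≤ D := by exact_mod_cast hD
    simp only [Nat.cast_one, div_one] at hL ⊢
    rw [← hL]
    nlinarith
  rcases lt_or_ge L 8 with hL8 | hL8
  · refine (requiresRounds_sources hD hk hn A).mono ?_
    nlinarith
  -- the largest `m` for which `4 ^ m * 2 ^ (r + k) ≤ (n / k) ^ r ≤ (n - 1).choose r` is guaranteed
  set r := k / 2 with hr
  have hr3 : (k : ℝ) ≤ 3 * r := by exact_mod_cast (by omega : k ≤ 3 * r)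
  have hr2 : 2 * (r : ℝ) ≤ k := by exact_mod_cast (by omega : 2 * r ≤ k)
  set m := ⌊(r : ℝ) * (L - 4) / 2⌋₊ with hm
  have hm1 : 2 * (m : ℝ) ≤ r * (L - 4) := by
    have := Nat.floor_le (a := (r : ℝ) * (L - 4) / 2) (by
      have : 0 ≤ L - 4 := by linarith
      positivity)
    linarith
  have hm2 : (r : ℝ) * (L - 4) / 2 < m + 1 := Nat.lt_floor_add_one _
  have hchoose : ((n : ℝ) / k) ^ r ≤ ((n - 1).choose r : ℝ) := by
    refine le_trans ?_ (Nat.pow_le_choose (α := ℝ) r (n - 1))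
    rw [le_div_iff₀ (by positivity), show n - 1 + 1 - r = n - r by omega,
      Nat.cast_sub (by omega)]
    calc ((n : ℝ) / k) ^ r * (r.factorial : ℝ)
        ≤ ((n : ℝ) / k) ^ r * (r : ℝ) ^ r := by
          gcongr
          exact_mod_cast Nat.factorial_le_pow r
      _ = ((n : ℝ) / k * r) ^ r := (mul_pow _ _ _).symm
      _ ≤ ((n : ℝ) - r) ^ r := by
          gcongr
          have hkn : (k : ℝ) ≤ n := by exact_mod_cast (by omega : k ≤ n)
          rw [div_mul_eq_mul_div, div_le_iff₀ hk0]
          nlinarith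
  have hpow : 4 ^ m * 2 ^ (r + k) ≤ (n - 1).choose r := by
    have h1 : ((4 : ℝ) ^ m * 2 ^ (r + k)) ≤ ((n : ℝ) / k) ^ r := by
      have e1 : ((4 : ℝ) ^ m * 2 ^ (r + k)) = (2 : ℝ) ^ ((2 * m + (r + k) : ℕ) : ℝ) := by
        rw [rpow_natCast, pow_add 2 (2 * m), pow_mul]; norm_num
      have e2 : ((n : ℝ) / k) ^ r = (2 : ℝ) ^ (L * r) := by
        rw [rpow_mul (by norm_num), rpow_natCast, hL,
          rpow_logb (by norm_num) (by norm_num) (by positivity)]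
      rw [e1, e2]
      apply rpow_le_rpow_of_exponent_le (by norm_num)
      push_cast
      nlinarith
    exact_mod_cast h1.trans hchoose
  refine (requiresRounds_unselected hD hk hn A (by omega) hpow).mono ?_
  push_cast
  nlinarith

open Real in
theorem requiresRounds_add {n D k : ℕ} (hD : 2 ≤ D) (hk : 1 ≤ k) (hn : 2 * D + k ≤ n + 1)
    (A : RadioAlgorithm (ℕ × Bool)) :
    RequiresRounds n D k A
      (1 / 72 * ((D : ℝ) * logb 2 n + (k : ℝ) * logb 2 ((n : ℝ) / k))) := by
  rcases le_total ((D : ℝ) * logb 2 n) ((k : ℝ) * logb 2 ((n : ℝ) / k)) with h | h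
  · exact (requiresRounds_mul_log_div hD hk hn A).mono (by linarith)
  · have h0 : 0 ≤ (D : ℝ) * logb 2 n := mul_nonneg (by positivity)
      (logb_nonneg (by norm_num) (by exact_mod_cast (by omega : 1 ≤ n)))
    exact (requiresRounds_mul_log hD hk hn A).mono (by linarith)

open Real in
/-- For `n ≥ n₀` the factor `log (n / k)` is at least `δ log n`; for `n < n₀` the number `k` of
sources is at most a constant multiple of `D`. -/
theorem exists_requiresRounds_of_le_rpow {ε K : ℝ} (hε1 : ε < 1) (hK : 0 < K) (hε : 0 < ε) :
    ∃ c : ℝ, 0 < c ∧ ∀ n D k : ℕ, 2 ≤ D → 1 ≤ k → 2 * D + k ≤ n + 1 → (k : ℝ) ≤ K * (n : ℝ) ^ ε →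
      ∀ A : RadioAlgorithm (ℕ × Bool),
        RequiresRounds n D k A (c * logb 2 n * ((D : ℝ) + k)) := by
  set δ := (1 - ε) / 2 with hδ
  have hδ0 : 0 < δ := by rw [hδ]; linarith
  set n₀ := K ^ δ⁻¹ with hn₀
  have hn₀0 : 0 < n₀ := rpow_pos_of_pos hK _
  refine ⟨1 / 72 * min δ (1 / (1 + n₀)), by positivity, fun n D k hD hk hn hkn A => ?_⟩
  refine (requiresRounds_add hD hk hn A).mono ?_
  have hn1 : (1 : ℝ) ≤ n := by exact_mod_cast (by omega : 1 ≤ n)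
  have hk0 : (0 : ℝ) < k := by exact_mod_cast hk
  have hD0 : (1 : ℝ) ≤ D := by exact_mod_cast (by omega : 1 ≤ D)
  have hlog : 0 ≤ logb 2 n := logb_nonneg (by norm_num) hn1
  have hkn' : (k : ℝ) ≤ n := by exact_mod_cast (by omega : k ≤ n)
  have hlog' : 0 ≤ logb 2 ((n : ℝ) / k) :=
    logb_nonneg (by norm_num) (by rwa [one_le_div hk0])
  rw [mul_assoc, mul_assoc]
  refine mul_le_mul_of_nonneg_left ?_ (by norm_num)
  rcases le_or_gt n₀ n with h | h
  · have hKn : K ≤ (n : ℝ) ^ δ := by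
      have := rpow_le_rpow hn₀0.le h hδ0.le
      rwa [hn₀, ← rpow_mul hK.le, inv_mul_cancel₀ hδ0.ne', rpow_one] at this
    have hdiv : (n : ℝ) ^ δ ≤ (n : ℝ) / k := by
      rw [le_div_iff₀ hk0]
      calc (n : ℝ) ^ δ * k ≤ (n : ℝ) ^ δ * ((n : ℝ) ^ δ * (n : ℝ) ^ ε) := by
            gcongr
            exact hkn.trans (by gcongr)
        _ = n := by
            rw [← rpow_add (by positivity), ← rpow_add (by positivity),
              show δ + (δ + ε) = 1 by rw [hδ]; ring, rpow_one]
    have hL : δ * logb 2 n ≤ logb 2 ((n : ℝ) / k) := by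
      rw [← logb_rpow_eq_mul_logb_of_pos (by positivity)]
      exact logb_le_logb_of_le (by norm_num) (by positivity) hdiv
    have hδ1 : δ ≤ 1 := by rw [hδ]; linarith
    calc min δ (1 / (1 + n₀)) * (logb 2 n * (D + k)) ≤ δ * (logb 2 n * (D + k)) :=
          mul_le_mul_of_nonneg_right (min_le_left _ _) (by positivity)
      _ = D * (δ * logb 2 n) + k * (δ * logb 2 n) := by ring
      _ ≤ D * logb 2 n + k * logb 2 (n / k) := by
          gcongr
          nlinarith
  · have hle : (D : ℝ) + k ≤ (1 + n₀) * D := by nlinarith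
    calc min δ (1 / (1 + n₀)) * (logb 2 n * (D + k))
        ≤ 1 / (1 + n₀) * (logb 2 n * (D + k)) :=
          mul_le_mul_of_nonneg_right (min_le_right _ _) (by positivity)
      _ ≤ 1 / (1 + n₀) * (logb 2 n * ((1 + n₀) * D)) := by gcongr
      _ = D * logb 2 n := by field_simp
      _ ≤ D * logb 2 n + k * logb 2 (n / k) := le_add_of_nonneg_right (by positivity)

/-! ### Relaying along a tree -/

/-- What a label tells a node. `addr` is the address of the node and `paddr` that of its parent in
the gathering tree. A node with `leaf` becomes active at the start, any other node becomes active
when it hears a packet with its address from its main child, that is, the child with `main`. An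
active node waits for the given time and then transmits once. The packets collect a number along
the chains of main children, to which each node appends its `bit`; a node with `starter` waits for
the number collected so far instead of for `wait`. -/
structure Advice where
  leaf : Bool
  main : Bool
  starter : Bool
  bit : Bool
  wait : ℕ
  addr : ℕ
  paddr : ℕ

/-- The number that a node with advice `a` has collected when its main child sends `x`. -/
def Advice.append (a : Advice) (x : ℕ) : ℕ := 2 * x + a.bit.toNat

/-- The number of rounds that a node with advice `a` waits after its main child has sent `x`. -/
def Advice.delay (a : Advice) (x : ℕ) : ℕ := if a.starter then a.append x else a.wait

/-- The reaction of an idle node to a packet, which consists of an address, the bit `main` of its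
transmitter, and a number: it ignores the packet, or it becomes active, which is described by the
remaining waiting time and the number that it is going to send. -/
def Advice.react (a : Advice) (p : ℕ × Bool × ℕ) : Option (ℕ × ℕ) :=
  if p.1 = a.addr ∧ p.2.1 = true then some (a.delay p.2.2, a.append p.2.2) else none

/-- The algorithm that gathers along a tree as described at `Advice`, where `dec` extracts the
advice from a label. The state of a node is its advice, and, if it is active, the remaining waiting
time and the number that it is going to send. -/
def relayAlgorithm {Λ : Type} (dec : Λ → Advice) : RadioAlgorithm Λ where
  State := Advice × Option (ℕ × ℕ)
  Packet := ℕ × Bool × ℕ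
  start x := (dec x, if (dec x).leaf then some ((dec x).wait, (dec x).bit.toNat) else none)
  wake x p := (dec x, (dec x).react p)
  send s := match s with
    | (a, some (0, x)) => some (a.paddr, a.main, x)
    | _ => none
  step s r := match s, r with
    | (a, some (0, _)), _ => (a, none)
    | (a, some (c + 1, x)), _ => (a, some (c, x))
    | (a, none), none => (a, none)
    | (a, none), some p => (a, a.react p)

/-- `w` is the main child of `v`, as far as the labels tell. -/
def IsMainChild {V : Type} (G : SimpleGraph V) (adv : V → Advice) (Act : V → Prop) (w v : V) :
    Prop :=
  Act w ∧ G.Adj v w ∧ (adv w).paddr = (adv v).addr ∧ (adv w).main = true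

/-- The advice `adv` is consistent with a schedule in which each node `v` with `Act v` transmits
exactly once, in round `θ v`, the number `num v`, and its parent `par v` hears it. The sink is `z`;
`free` excludes collisions at the parents, and by `trigger` a node that reacts to a packet does so
in accordance with the schedule. -/
structure RealizesSchedule {V : Type} (G : SimpleGraph V) (S : Finset V) (z : V)
    (adv : V → Advice) (Act : V → Prop) (par : V → V) (θ num : V → ℕ) : Prop where
  adj : ∀ v, Act v → G.Adj v (par v)
  free : ∀ u w, Act u → Act w → θ u = θ w → G.Adj (par w) u ∨ u = par w → u = w
  up : ∀ v, Act v → par v = z ∨ (Act (par v) ∧ θ v < θ (par v))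
  source : ∀ v ∈ S, v = z ∨ Act v
  leaf : ∀ v, (adv v).leaf = true → Act v → v ∈ S ∧ θ v = (adv v).wait ∧
    num v = (adv v).bit.toNat
  leaf_act : ∀ v, (adv v).leaf = true → Act v
  child : ∀ v, Act v → (adv v).leaf = false → ∃ w, IsMainChild G adv Act w v
  unique : ∀ w w' v, IsMainChild G adv Act w v → IsMainChild G adv Act w' v → w = w'
  trigger : ∀ w v, IsMainChild G adv Act w v → Act v ∧ (adv v).leaf = false ∧ par w = v ∧
    θ v = θ w + 1 + (adv v).delay (num w) ∧ num v = (adv v).append (num w)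

namespace RealizesSchedule

variable {V Λ : Type} {G : SimpleGraph V} {S : Finset V} {z : V} {dec : Λ → Advice}
  {lab : V → Λ} {Act : V → Prop} {par : V → V} {θ num : V → ℕ}

/-- The possible states of the node `v` at the beginning of round `t`, according to the schedule:
a node that is never active is asleep or idle, and so is an active node until its main child
transmits; then the node waits for its round `θ v`, after which it is idle. -/
structure Invariant (G : SimpleGraph V) (S : Finset V) (dec : Λ → Advice) (lab : V → Λ)
    (Act : V → Prop) (θ num : V → ℕ) (t : ℕ) (v : V) : Prop where
  passive : ¬ Act v → (relayAlgorithm dec).state G lab S t v = none ∨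
    (relayAlgorithm dec).state G lab S t v = some (dec (lab v), none)
  early : ∀ w, IsMainChild G (fun v => dec (lab v)) Act w v → t ≤ θ w →
    (relayAlgorithm dec).state G lab S t v = none ∨
    (relayAlgorithm dec).state G lab S t v = some (dec (lab v), none)
  pending : Act v → ((dec (lab v)).leaf = true ∨
      ∃ w, IsMainChild G (fun v => dec (lab v)) Act w v ∧ θ w < t) → t ≤ θ v →
    (relayAlgorithm dec).state G lab S t v = some (dec (lab v), some (θ v - t, num v))
  late : Act v → θ v < t → (relayAlgorithm dec).state G lab S t v = some (dec (lab v), none)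

open Classical in
theorem transmits_of_invariant
    (h : RealizesSchedule G S z (fun v => dec (lab v)) Act par θ num) {t : ℕ} {v : V}
    (hv : Invariant G S dec lab Act θ num t v) :
    (relayAlgorithm dec).transmits G lab S t v =
      if Act v ∧ θ v = t then some ((dec (lab v)).paddr, (dec (lab v)).main, num v) else none := by
  have idle : ((relayAlgorithm dec).state G lab S t v = none ∨
      (relayAlgorithm dec).state G lab S t v = some (dec (lab v), none)) →
      (relayAlgorithm dec).transmits G lab S t v = none := by
    rintro (h | h) <;> rw [RadioAlgorithm.transmits, h] <;> rfl
  by_cases hA : Act v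
  · rcases lt_trichotomy (θ v) t with hlt | heq | hgt
    · rw [if_neg (by omega)]
      exact idle (.inr (hv.late hA hlt))
    · rw [if_pos ⟨hA, heq⟩, RadioAlgorithm.transmits, hv.pending hA ?_ heq.ge, heq, Nat.sub_self]
      · rfl
      · cases hl : (dec (lab v)).leaf with
        | true => exact .inl rfl
        | false =>
          obtain ⟨w, hw⟩ := h.child v hA hl
          have := (h.trigger w v hw).2.2.2.1
          exact .inr ⟨w, hw, by omega⟩
    · rw [if_neg (by omega)]
      by_cases hp : (dec (lab v)).leaf = true ∨
          ∃ w, IsMainChild G (fun v => dec (lab v)) Act w v ∧ θ w < t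
      · rw [RadioAlgorithm.transmits, hv.pending hA hp hgt.le,
          show θ v - t = (θ v - t - 1) + 1 by omega]
        rfl
      · rw [not_or, Bool.not_eq_true] at hp
        obtain ⟨w, hw⟩ := h.child v hA hp.1
        exact idle (hv.early w hw (not_lt.1 fun hlt => hp.2 ⟨w, hw, hlt⟩))
  · rw [if_neg (fun h => hA h.1)]
    exact idle (hv.passive hA)

open Classical in
theorem hears_par (h : RealizesSchedule G S z (fun v => dec (lab v)) Act par θ num) {w : V}
    (hw : Act w) (hinv : ∀ v, Invariant G S dec lab Act θ num (θ w) v) :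
    Hears G ((relayAlgorithm dec).transmits G lab S (θ w)) (par w) w := by
  have htx := fun v => h.transmits_of_invariant (hinv v)
  refine ⟨?_, (h.adj w hw).symm, ?_, fun u hu hut => ?_⟩
  · refine (htx (par w)).trans (if_neg ?_)
    rintro ⟨hp, hpt⟩
    have := h.free (par w) w hp hw hpt (.inr rfl)
    have hadj := h.adj w hw
    rw [this] at hadj
    exact G.loopless.irrefl _ hadj
  · rw [htx, if_pos ⟨hw, rfl⟩]
    exact Option.some_ne_none _
  · rw [htx] at hut
    by_cases hc : Act u ∧ θ u = θ w
    · exact h.free u w hc.1 hw hc.2 (.inl hu)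
    · rw [if_neg hc] at hut
      exact absurd rfl hut

open Classical in
theorem invariant (h : RealizesSchedule G S z (fun v => dec (lab v)) Act par θ num) (t : ℕ) :
    ∀ v, Invariant G S dec lab Act θ num t v := by
  induction t with
  | zero =>
    intro v
    have hidle : (dec (lab v)).leaf = false → (relayAlgorithm dec).state G lab S 0 v = none ∨
        (relayAlgorithm dec).state G lab S 0 v = some (dec (lab v), none) := by
      intro hl
      by_cases hv : v ∈ S
      · right
        rw [RadioAlgorithm.state_zero_of_mem _ _ _ _ hv]
        simp [relayAlgorithm, hl]
      · exact .inl (RadioAlgorithm.state_zero_of_notMem _ _ _ _ hv)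
    refine ⟨fun hA => hidle ?_, fun w hw _ => hidle (h.trigger w v hw).2.1, fun hA hp _ => ?_,
      fun _ h0 => absurd h0 (Nat.not_lt_zero _)⟩
    · rw [← Bool.not_eq_true]
      exact fun hl => hA (h.leaf_act v hl)
    · rcases hp with hl | ⟨w, -, hw⟩
      · obtain ⟨hS, hθ, hnum⟩ := h.leaf v hl hA
        rw [RadioAlgorithm.state_zero_of_mem _ _ _ _ hS, hθ, hnum]
        simp [relayAlgorithm, hl]
      · exact absurd hw (Nat.not_lt_zero _)
  | succ t ih =>
    intro v
    have htx := fun v => h.transmits_of_invariant (ih v)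
    have hsucc := (relayAlgorithm dec).state_succ G lab S t v
    -- an idle node stays idle unless its main child transmits
    have hidle : ((relayAlgorithm dec).state G lab S t v = none ∨
        (relayAlgorithm dec).state G lab S t v = some (dec (lab v), none)) →
        (∀ w, IsMainChild G (fun v => dec (lab v)) Act w v → θ w ≠ t) →
        (relayAlgorithm dec).state G lab S (t + 1) v = none ∧
          (relayAlgorithm dec).state G lab S t v = none ∨
        (relayAlgorithm dec).state G lab S (t + 1) v = some (dec (lab v), none) := by
      intro hst hne
      by_cases hex : ∃ w, Hears G ((relayAlgorithm dec).transmits G lab S t) v w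
      · obtain ⟨w, hw⟩ := hex
        have hwt := hw.2.2.1
        rw [htx] at hwt
        have hwA : Act w ∧ θ w = t := by
          by_contra hc
          rw [if_neg hc] at hwt
          exact hwt rfl
        have hreact : (dec (lab v)).react ((dec (lab w)).paddr, (dec (lab w)).main, num w) =
            none := by
          rw [Advice.react, if_neg]
          exact fun hc => hne w ⟨hwA.1, hw.2.1, hc.1, hc.2⟩ hwA.2
        right
        rw [hsucc, received_of_hears hw, htx, if_pos hwA]
        rcases hst with hst | hst <;> rw [hst]
        · exact congrArg (fun x => some (dec (lab v), x)) hreact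
        · exact congrArg (fun x => some (dec (lab v), x)) hreact
      · rw [hsucc, received_eq_none (not_exists.1 hex)]
        rcases hst with hst | hst <;> rw [hst]
        · exact .inl ⟨rfl, rfl⟩
        · exact .inr rfl
    have hidle' := fun h1 h2 => (hidle h1 h2).imp And.left id
    refine ⟨fun hA => hidle' ((ih v).passive hA) fun w hw => absurd (h.trigger w v hw).1 hA,
      fun w hw ht => hidle' ((ih v).early w hw (by omega)) fun w' hw' => ?_,
      fun hA hp ht => ?_, fun hA ht => ?_⟩
    · rw [h.unique w' w v hw' hw]; omega
    · by_cases hold : (dec (lab v)).leaf = true ∨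
          ∃ w, IsMainChild G (fun v => dec (lab v)) Act w v ∧ θ w < t
      · rw [hsucc, (ih v).pending hA hold (by omega),
          show θ v - t = (θ v - (t + 1)) + 1 by omega]
        rfl
      · rw [not_or] at hold
        rcases hp with hl | ⟨w, hw, hwt⟩
        · exact absurd hl hold.1
        · have hwt' : θ w = t := by
            have : ¬ θ w < t := fun hlt => hold.2 ⟨w, hw, hlt⟩
            omega
          obtain ⟨-, -, hpar, hθ, hnum⟩ := h.trigger w v hw
          have hh := h.hears_par hw.1 (fun v => hwt' ▸ ih v)
          rw [hpar, hwt'] at hh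
          rw [hsucc, received_of_hears hh, htx, if_pos ⟨hw.1, hwt'⟩]
          have hreact : (dec (lab v)).react ((dec (lab w)).paddr, (dec (lab w)).main, num w) =
              some (θ v - (t + 1), num v) := by
            rw [Advice.react, if_pos ⟨hw.2.2.1, hw.2.2.2⟩, hnum,
              show θ v - (t + 1) = (dec (lab v)).delay (num w) by omega]
          rcases (ih v).early w hw hwt'.ge with hst | hst <;> rw [hst]
          · exact congrArg (fun x => some (dec (lab v), x)) hreact
          · exact congrArg (fun x => some (dec (lab v), x)) hreact
    · rcases (Nat.lt_succ_iff.1 ht).lt_or_eq with hlt | heq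
      · have hst := (ih v).late hA hlt
        rcases hidle (.inr hst) fun w hw => by
          have := (h.trigger w v hw).2.2.2.1; omega with h1 | h1
        · rw [hst] at h1; exact absurd h1.2 (by simp)
        · exact h1
      · have hp : (dec (lab v)).leaf = true ∨
            ∃ w, IsMainChild G (fun v => dec (lab v)) Act w v ∧ θ w < t := by
          cases hl : (dec (lab v)).leaf with
          | true => exact .inl rfl
          | false =>
            obtain ⟨w, hw⟩ := h.child v hA hl
            have := (h.trigger w v hw).2.2.2.1
            exact .inr ⟨w, hw, by omega⟩
        rw [hsucc, (ih v).pending hA hp heq.ge, heq, Nat.sub_self]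
        rfl

/-- All messages reach the sink as soon as all nodes have transmitted. -/
theorem known_sink (h : RealizesSchedule G S z (fun v => dec (lab v)) Act par θ num) {T : ℕ}
    (hT : ∀ v, Act v → θ v < T) {s : V} (hs : s ∈ S) :
    s ∈ (relayAlgorithm dec).known G lab S T z := by
  have key : ∀ j v, Act v → T - θ v = j → s ∈ (relayAlgorithm dec).known G lab S (θ v) v →
      s ∈ (relayAlgorithm dec).known G lab S T z := by
    intro j
    induction j using Nat.strong_induction_on with
    | _ j ih =>
      intro v hv hj hsv
      have hpar : s ∈ (relayAlgorithm dec).known G lab S (θ v + 1) (par v) :=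
        .inr ⟨v, h.hears_par hv (h.invariant _), hsv⟩
      have := hT v hv
      rcases h.up v hv with hz | ⟨hA, hlt⟩
      · rw [← hz]
        exact RadioAlgorithm.known_mono _ (by omega) _ hpar
      · have := hT _ hA
        exact ih (T - θ (par v)) (by omega) (par v) hA rfl
          (RadioAlgorithm.known_mono _ (by omega) _ hpar)
  have h0 : s ∈ (relayAlgorithm dec).known G lab S 0 s := ⟨hs, rfl⟩
  rcases h.source s hs with rfl | hA
  · exact RadioAlgorithm.known_mono _ (Nat.zero_le _) _ h0
  · exact key _ s hA rfl (RadioAlgorithm.known_mono _ (Nat.zero_le _) _ h0)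

end RealizesSchedule

/-! ### Gathering trees -/

/-- A breadth-first tree of `G` rooted at the sink `z`, in which `par` maps a node to its parent,
together with a ranking of the sources such that sources of higher rank are not less deep. -/
structure GatheringTree {V : Type} (G : SimpleGraph V) (S : Finset V) (z : V) where
  par : V → V
  depth : V → ℕ
  rank : V → ℕ
  adj_par : ∀ v, v ≠ z → G.Adj v (par v)
  depth_par : ∀ v, v ≠ z → depth (par v) + 1 = depth v
  depth_root : depth z = 0
  depth_le_of_adj : ∀ u v, G.Adj u v → depth u ≤ depth v + 1
  rank_lt : ∀ s ∈ S, rank s < S.card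
  rank_inj : ∀ s ∈ S, ∀ s' ∈ S, rank s = rank s' → s = s'
  depth_mono : ∀ s ∈ S, ∀ s' ∈ S, rank s < rank s' → depth s ≤ depth s'

theorem exists_gatheringTree {V : Type} [LinearOrder V] {G : SimpleGraph V}
    (hG : G.Connected) (S : Finset V) (z : V) :
    ∃ T : GatheringTree G S z, ∀ v, T.depth v = G.dist v z := by
  classical
  have hpar : ∀ v, ∃ p, v ≠ z → G.Adj v p ∧ G.dist p z + 1 = G.dist v z := by
    intro v
    obtain ⟨q, hq⟩ := hG.exists_walk_length_eq_dist v z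
    cases q with
    | nil => exact ⟨z, fun h => absurd rfl h⟩
    | @cons _ p _ hadj q =>
      refine ⟨p, fun _ => ⟨hadj, ?_⟩⟩
      have h1 := SimpleGraph.dist_le q
      have h2 := hG.dist_triangle (u := v) (v := p) (w := z)
      rw [SimpleGraph.dist_eq_one_iff_adj.2 hadj] at h2
      rw [SimpleGraph.Walk.length_cons] at hq
      omega
  choose par hpar using hpar
  let key : V → ℕ ×ₗ V := fun v => toLex (G.dist v z, v)
  have hkey : ∀ u v, key u = key v → u = v := fun u v h => congrArg (fun x => (ofLex x).2) h
  let rank : V → ℕ := fun v => (S.filter fun u => key u < key v).card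
  have hrank : ∀ s ∈ S, ∀ s', key s < key s' → rank s < rank s' := by
    intro s hs s' h
    refine Finset.card_lt_card ((Finset.ssubset_iff_of_subset fun u hu => ?_).2 ⟨s, ?_, ?_⟩)
    · rw [Finset.mem_filter] at hu ⊢
      exact ⟨hu.1, hu.2.trans h⟩
    · exact Finset.mem_filter.2 ⟨hs, h⟩
    · simp
  refine ⟨⟨par, fun v => G.dist v z, rank, fun v hv => (hpar v hv).1, fun v hv => (hpar v hv).2,
    SimpleGraph.dist_self, fun u v huv => ?_, fun s hs => ?_, fun s hs s' hs' h => ?_,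
    fun s hs s' hs' h => ?_⟩, fun _ => rfl⟩
  · have h2 := hG.dist_triangle (u := u) (v := v) (w := z)
    rw [SimpleGraph.dist_eq_one_iff_adj.2 huv] at h2
    omega
  · exact Finset.card_lt_card ((Finset.ssubset_iff_of_subset (Finset.filter_subset _ _)).2
      ⟨s, hs, by simp⟩)
  · rcases lt_trichotomy (key s) (key s') with hlt | heq | hgt
    · exact absurd h (hrank s hs s' hlt).ne
    · exact hkey s s' heq
    · exact absurd h (hrank s' hs' s hgt).ne'
  · by_contra hlt
    have : key s' < key s := Prod.Lex.toLex_lt_toLex.2 (.inl (not_le.1 hlt))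
    exact absurd (hrank s' hs' s this) (by omega)

namespace GatheringTree

variable {V : Type} {G : SimpleGraph V} {S : Finset V} {z : V} (T : GatheringTree G S z)

/-- The node `v` lies on the path from the source `s` to the root. -/
def Above (s v : V) : Prop :=
  s ∈ S ∧ T.depth v ≤ T.depth s ∧ T.par^[T.depth s - T.depth v] s = v

/-- The node `v` has a message to transmit: it lies above a source, and it is not the sink. -/
def Active (v : V) : Prop := v ≠ z ∧ ∃ s, T.Above s v

theorem depth_iterate {s : V} {i : ℕ} (hi : i ≤ T.depth s) :
    T.depth (T.par^[i] s) = T.depth s - i := by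
  induction i with
  | zero => rfl
  | succ i ih =>
    have h := ih (by omega)
    rw [Function.iterate_succ_apply']
    have hne : T.par^[i] s ≠ z := fun h0 => by rw [h0, T.depth_root] at h; omega
    have := T.depth_par _ hne
    omega

theorem above_self {s : V} (hs : s ∈ S) : T.Above s s := ⟨hs, le_rfl, by simp⟩

variable {T}

theorem Above.par {s v : V} (h : T.Above s v) (hv : v ≠ z) : T.Above s (T.par v) := by
  obtain ⟨hs, hd, hi⟩ := h
  have := T.depth_par v hv
  refine ⟨hs, by omega, ?_⟩
  rw [show T.depth s - T.depth (T.par v) = T.depth s - T.depth v + 1 by omega,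
    Function.iterate_succ_apply', hi]

theorem Above.eq {s u v : V} (hu : T.Above s u) (hv : T.Above s v)
    (h : T.depth u = T.depth v) : u = v := by
  rw [← hu.2.2, h, hv.2.2]

theorem Above.exists_child {s v : V} (h : T.Above s v) (hlt : T.depth v < T.depth s) :
    ∃ w, w ≠ z ∧ T.par w = v ∧ T.Above s w ∧ T.par^[T.depth s - T.depth v - 1] s = w := by
  obtain ⟨hs, hd, hi⟩ := h
  have hdw := T.depth_iterate (s := s) (i := T.depth s - T.depth v - 1) (by omega)
  set w := T.par^[T.depth s - T.depth v - 1] s with hw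
  refine ⟨w, fun h0 => ?_, ?_, ⟨hs, by omega, ?_⟩, rfl⟩
  · rw [h0, T.depth_root] at hdw; omega
  · rw [hw, ← Function.iterate_succ_apply' T.par,
      show (T.depth s - T.depth v - 1).succ = T.depth s - T.depth v by omega, hi]
  · rw [hdw, hw]; congr 1; omega

variable (T)

open Classical in
/-- The source of highest rank, hence also of maximal depth, below `v`; if there is no source below
`v`, the value is `v` itself. -/
noncomputable def top (v : V) : V :=
  if h : (S.filter fun s => T.Above s v).Nonempty then
    (Finset.exists_max_image _ T.rank h).choose
  else v

theorem top_spec {v s : V} (h : T.Above s v) :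
    T.Above (T.top v) v ∧ ∀ s, T.Above s v → T.rank s ≤ T.rank (T.top v) := by
  classical
  have hne : (S.filter fun s => T.Above s v).Nonempty := ⟨s, Finset.mem_filter.2 ⟨h.1, h⟩⟩
  have hspec := (Finset.exists_max_image _ T.rank hne).choose_spec
  rw [top, dif_pos hne]
  exact ⟨(Finset.mem_filter.1 hspec.1).2,
    fun s hs => hspec.2 s (Finset.mem_filter.2 ⟨hs.1, hs⟩)⟩

/-- The height of `v` in the union of the paths from the sources to the root. -/
noncomputable def height (v : V) : ℕ := T.depth (T.top v) - T.depth v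

variable {T}

theorem Active.above_top {v : V} (h : T.Active v) : T.Above (T.top v) v :=
  (T.top_spec h.2.choose_spec).1

theorem Active.height_add_depth {v : V} (h : T.Active v) :
    T.height v + T.depth v = T.depth (T.top v) := by
  have := h.above_top.2.1
  rw [height]; omega

theorem Active.top_eq_iff {v : V} (h : T.Active v) {s : V} (hs : s ∈ S) :
    T.top v = s ↔ T.rank (T.top v) = T.rank s :=
  ⟨fun h => h ▸ rfl, T.rank_inj _ h.above_top.1 s hs⟩

/-- Passing to the parent, the rank of the source on top does not decrease, and neither does its
depth, so that the height increases. -/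
theorem Active.rank_top_le {v u : V} (hv : T.Active v) (hu : T.par v = u) :
    T.rank (T.top v) ≤ T.rank (T.top u) ∧ T.height v < T.height u := by
  subst hu
  have h1 := hv.above_top.par hv.1
  obtain ⟨h2, h3⟩ := T.top_spec h1
  have h4 := h3 _ h1
  refine ⟨h4, ?_⟩
  have h5 : T.depth (T.top v) ≤ T.depth (T.top (T.par v)) := by
    rcases h4.eq_or_lt with h | h
    · rw [T.rank_inj _ hv.above_top.1 _ h2.1 h]
    · exact T.depth_mono _ hv.above_top.1 _ h2.1 h
  have h6 := T.depth_par v hv.1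
  have h7 := hv.height_add_depth
  have : T.height (T.par v) = T.depth (T.top (T.par v)) - T.depth (T.par v) := rfl
  omega

theorem Active.active_par {v : V} (hv : T.Active v) (h : T.par v ≠ z) : T.Active (T.par v) :=
  ⟨h, _, hv.above_top.par hv.1⟩

theorem Active.eq_of_top_eq {u v : V} (hu : T.Active u) (hv : T.Active v)
    (htop : T.top u = T.top v) (hd : T.depth u = T.depth v) : u = v :=
  hu.above_top.eq (htop ▸ hv.above_top) hd

/-- A node of height `0` is itself the source of highest rank below it. -/
theorem Active.eq_top {v : V} (hv : T.Active v) (h : T.height v = 0) : v = T.top v := by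
  have h1 := hv.height_add_depth
  have h2 := hv.above_top.2.2
  rw [show T.depth (T.top v) - T.depth v = 0 by omega] at h2
  exact h2.symm

/-- A node of positive height has a main child, that is, a child with the same `top`, and it lies on
the path from this source. -/
theorem Active.exists_main {v : V} (hv : T.Active v) (h : 0 < T.height v) :
    ∃ w, T.Active w ∧ T.par w = v ∧ T.top w = T.top v ∧ T.height w + 1 = T.height v ∧
      T.par^[T.height v - 1] (T.top v) = w := by
  obtain ⟨w, hwz, hwv, hw, hit⟩ := hv.above_top.exists_child (by
    have := hv.height_add_depth; omega)
  have hA : T.Active w := ⟨hwz, _, hw⟩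
  obtain ⟨h1, h2⟩ := T.top_spec hw
  have h3 := (T.top_spec hv.above_top).2 _ (hwv ▸ h1.par hwz)
  have htop : T.top w = T.top v :=
    T.rank_inj _ h1.1 _ hv.above_top.1 (le_antisymm h3 (h2 _ hw))
  refine ⟨w, hA, hwv, htop, ?_, hit⟩
  have e1 := T.depth_par w hwz
  have e2 := hA.height_add_depth
  have e3 := hv.height_add_depth
  rw [hwv] at e1
  rw [htop] at e2
  omega

/-- By the choice of the ranking, the sums `depth + 3 * rank` of the sources differ by at least `3`,
so that nodes with different sources on top and the same sum `height + 3 * rank` are at least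
three levels apart. -/
theorem Active.eq_of_height_add_rank {u v : V} (hu : T.Active u) (hv : T.Active v)
    (h : T.height u + 3 * T.rank (T.top u) = T.height v + 3 * T.rank (T.top v))
    (h1 : T.depth u ≤ T.depth v + 2) (h2 : T.depth v ≤ T.depth u + 2) : u = v := by
  have e1 := hu.height_add_depth
  have e2 := hv.height_add_depth
  have m1 := T.depth_mono _ hu.above_top.1 _ hv.above_top.1
  have m2 := T.depth_mono _ hv.above_top.1 _ hu.above_top.1
  have hr : T.rank (T.top u) = T.rank (T.top v) := by
    rcases lt_trichotomy (T.rank (T.top u)) (T.rank (T.top v)) with hlt | heq | hgt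
    · have := m1 hlt; omega
    · exact heq
    · have := m2 hgt; omega
  have htop := (hu.top_eq_iff hv.above_top.1).2 hr
  refine hu.eq_of_top_eq hv htop ?_
  rw [htop] at e1
  omega

/-! ### The schedule of a gathering tree -/

/-- Active nodes at distance at most two have different colours. -/
def IsColoring (T : GatheringTree G S z) (col : V → ℕ) : Prop :=
  ∀ u w, T.Active u → T.Active w → u ≠ w → (G.Adj u w ∨ ∃ x, G.Adj x u ∧ G.Adj x w) →
    col u ≠ col w

variable (T) (col : V → ℕ) (χ r : ℕ)

/-- The round in which an active node transmits. The nodes of height less than `r` follow a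
time-division schedule, a period of `χ` rounds for each height and a round of it for each colour.
After that the nodes of height `r` start, with delays by which all further transmissions
are passed on without waiting and do not interfere. -/
noncomputable def slot (v : V) : ℕ :=
  if T.height v < r then χ * T.height v + col v else r * χ + T.height v + 3 * T.rank (T.top v)

/-- The waiting time of the node of height `r` below which the source `s` is on top. If `r = 0`,
this node is a source, whose waiting time is part of its label. -/
noncomputable def target (s : V) : ℕ :=
  if r = 0 then 0 else χ + r + 3 * T.rank s - col (T.par^[r - 1] s) - 1

/-- The number that an active node has collected. A node of height `j ≤ r` has the `j + 1` leading
ones among the `r + 1` binary digits of the target. -/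
noncomputable def collected (v : V) : ℕ :=
  T.target col χ r (T.top v) / 2 ^ (r - T.height v) * 2 ^ (T.height v - r)

open Classical in
/-- The advice by which the active nodes follow the schedule `slot`. The addresses `0` and `1`
are not used by any active node: `0` belongs to nodes that never react, and `1` is the sink. -/
noncomputable def advice (v : V) : Advice :=
  if T.Active v then
    { leaf := decide (T.height v = 0)
      main := decide (T.top (T.par v) = T.top v)
      starter := decide (0 < r ∧ T.height v = r)
      bit := decide (T.height v ≤ r ∧
        T.target col χ r (T.top v) / 2 ^ (r - T.height v) % 2 = 1)
      wait := if T.height v = 0 then T.slot col χ r v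
        else if T.height v < r then
          χ + col v - col (T.par^[T.height v - 1] (T.top v)) - 1
        else 0
      addr := col v + 2
      paddr := if T.par v = z then 1 else col (T.par v) + 2 }
  else ⟨false, false, false, false, 0, 0, 0⟩

variable {col χ r}

theorem slot_lt_slot (hχ : ∀ v, col v < χ) {v u : V} (hv : T.Active v) (hu : T.par v = u) :
    T.slot col χ r v < T.slot col χ r u := by
  obtain ⟨h1, h2⟩ := hv.rank_top_le hu
  have hc := hχ v
  rw [slot, slot]
  split_ifs with h3 h4
  · have := Nat.mul_le_mul_left χ (Nat.succ_le_of_lt h2)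
    rw [Nat.mul_succ] at this
    omega
  · have := Nat.mul_le_mul_left χ (Nat.succ_le_of_lt h3)
    rw [Nat.mul_succ, Nat.mul_comm χ r] at this
    omega
  · omega
  · omega

theorem slot_ne_slot (hcol : T.IsColoring col) (hχ : ∀ v, col v < χ) {u w : V}
    (hu : T.Active u) (hw : T.Active w) (hne : u ≠ w) (h : G.Adj (T.par w) u ∨ u = T.par w) :
    T.slot col χ r u ≠ T.slot col χ r w := by
  intro heq
  have hadj := T.adj_par w hw.1
  have hcu := hχ u
  have hcw := hχ w
  have hc : col u ≠ col w := by
    refine hcol u w hu hw hne ?_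
    rcases h with h | h
    · exact .inr ⟨_, h, hadj.symm⟩
    · exact .inl (h ▸ hadj.symm)
  have hdw := T.depth_par w hw.1
  have hd : T.depth u ≤ T.depth (T.par w) + 1 ∧ T.depth (T.par w) ≤ T.depth u + 1 := by
    rcases h with h | h
    · exact ⟨T.depth_le_of_adj _ _ h.symm, T.depth_le_of_adj _ _ h⟩
    · rw [h]; omega
  rw [slot, slot] at heq
  split_ifs at heq with h1 h2 h2
  · have hmod := congrArg (· % χ) heq
    simp only [Nat.mul_add_mod, Nat.mod_eq_of_lt hcu, Nat.mod_eq_of_lt hcw] at hmod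
    exact hc hmod
  · have := Nat.mul_le_mul_left χ (Nat.succ_le_of_lt h1)
    rw [Nat.mul_succ, Nat.mul_comm χ r] at this
    omega
  · have := Nat.mul_le_mul_left χ (Nat.succ_le_of_lt h2)
    rw [Nat.mul_succ, Nat.mul_comm χ r] at this
    omega
  · exact hne (hu.eq_of_height_add_rank hw (by omega) (by omega) (by omega))

theorem target_lt (hr : 0 < r → χ + r + 3 * S.card ≤ 2 ^ (r + 1)) {s : V} (hs : s ∈ S) :
    T.target col χ r s < 2 ^ (r + 1) := by
  rw [target]
  split_ifs with h
  · positivity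
  · have h1 := hr (by omega)
    have h2 := T.rank_lt s hs
    omega

/-- A main child, as far as the labels tell, is the child with the same `top`. -/
theorem eq_of_isMainChild (hcol : T.IsColoring col) {w v : V}
    (h : IsMainChild G (T.advice col χ r) T.Active w v) :
    T.Active v ∧ T.par w = v ∧ T.top v = T.top w := by
  obtain ⟨hw, hadj, haddr, hmain⟩ := h
  have hv : T.Active v := by
    by_contra hv
    rw [advice, if_pos hw, advice, if_neg hv] at haddr
    dsimp only at haddr
    split_ifs at haddr
  rw [advice, if_pos hw, advice, if_pos hv] at haddr
  rw [advice, if_pos hw] at hmain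
  dsimp only at haddr hmain
  have hpv : T.par w = v := by
    split_ifs at haddr with hz
    · omega
    · by_contra hne
      exact hcol _ _ (hw.active_par hz) hv hne
        (.inr ⟨w, T.adj_par w hw.1, hadj.symm⟩) (by omega)
  exact ⟨hv, hpv, by rw [← hpv]; simpa using hmain⟩

theorem realizesSchedule (hcol : T.IsColoring col) (hχ : ∀ v, col v < χ)
    (hr : 0 < r → χ + r + 3 * S.card ≤ 2 ^ (r + 1)) :
    RealizesSchedule G S z (T.advice col χ r) T.Active T.par (T.slot col χ r)
      (T.collected col χ r) where
  adj v hv := T.adj_par v hv.1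
  free u w hu hw heq h := by
    by_contra hne
    exact T.slot_ne_slot hcol hχ hu hw hne h heq
  up v hv := by
    by_cases h : T.par v = z
    · exact .inl h
    · exact .inr ⟨hv.active_par h, T.slot_lt_slot hχ hv rfl⟩
  source v hv := or_iff_not_imp_left.2 fun h => ⟨h, v, T.above_self hv⟩
  leaf_act v hl := by
    by_contra hv
    rw [advice, if_neg hv] at hl
    exact absurd hl (by simp)
  leaf v hl hv := by
    rw [advice, if_pos hv] at hl ⊢
    have h0 : T.height v = 0 := of_decide_eq_true hl
    refine ⟨?_, ?_, ?_⟩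
    · rw [hv.eq_top h0]; exact hv.above_top.1
    · simp [h0]
    · have hlt := T.target_lt (col := col) hr hv.above_top.1
      have h2 : T.target col χ r (T.top v) / 2 ^ r < 2 := by
        rw [Nat.div_lt_iff_lt_mul (by positivity), ← pow_succ']; exact hlt
      simp only [collected, h0, Nat.sub_zero, Nat.zero_sub, pow_zero, mul_one, Nat.zero_le,
        true_and]
      generalize T.target col χ r (T.top v) / 2 ^ r = q at h2
      by_cases h : q % 2 = 1
      · simp only [h, decide_true, Bool.toNat_true]; omega
      · simp only [h, decide_false, Bool.toNat_false]; omega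
  child v hv hl := by
    have h0 : T.height v ≠ 0 := by
      rw [advice, if_pos hv] at hl
      exact of_decide_eq_false hl
    obtain ⟨w, hw, hwv, htop, -, -⟩ := hv.exists_main (Nat.pos_of_ne_zero h0)
    refine ⟨w, hw, by rw [← hwv]; exact (T.adj_par w hw.1).symm, ?_, ?_⟩
    · rw [advice, if_pos hw, advice, if_pos hv]
      dsimp only
      rw [hwv, if_neg hv.1]
    · rw [advice, if_pos hw]
      dsimp only
      rw [hwv, htop]
      simp
  unique w w' v h h' := by
    obtain ⟨-, hp, ht⟩ := T.eq_of_isMainChild hcol h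
    obtain ⟨-, hp', ht'⟩ := T.eq_of_isMainChild hcol h'
    refine h.1.eq_of_top_eq h'.1 (ht.symm.trans ht') ?_
    have e1 := T.depth_par w h.1.1
    have e2 := T.depth_par w' h'.1.1
    rw [hp] at e1
    rw [hp'] at e2
    omega
  trigger w v h := by
    obtain ⟨hv, hpar, htop⟩ := T.eq_of_isMainChild hcol h
    have hw := h.1
    have hlt := (hw.rank_top_le hpar).2
    obtain ⟨w', hw', hwv', htop', hh, hit⟩ := hv.exists_main (by omega)
    obtain rfl : w' = w := by
      refine hw'.eq_of_top_eq hw (htop'.trans htop) ?_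
      have e1 := T.depth_par w' hw'.1
      have e2 := T.depth_par w hw.1
      rw [hwv'] at e1
      rw [hpar] at e2
      omega
    have hlf : (T.advice col χ r v).leaf = false := by
      rw [advice, if_pos hv]
      exact decide_eq_false (by omega)
    have hnum : T.collected col χ r v =
        (T.advice col χ r v).append (T.collected col χ r w') := by
      rw [Advice.append, advice, if_pos hv]
      dsimp only
      rw [collected, collected, htop']
      set N := T.target col χ r (T.top v)
      by_cases hle : T.height v ≤ r
      · -- one more binary digit of the target
        have hdiv : N / 2 ^ (r - T.height w') = N / 2 ^ (r - T.height v) / 2 := by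
          rw [Nat.div_div_eq_div_mul, ← pow_succ]
          congr 2
          omega
        rw [hdiv, show T.height v - r = 0 by omega, show T.height w' - r = 0 by omega]
        simp only [hle, true_and, pow_zero, mul_one]
        by_cases hb : N / 2 ^ (r - T.height v) % 2 = 1
        · simp only [hb, decide_true, Bool.toNat_true]; omega
        · simp only [hb, decide_false, Bool.toNat_false]; omega
      · rw [show r - T.height v = 0 by omega, show r - T.height w' = 0 by omega,
          show T.height v - r = T.height w' - r + 1 by omega, pow_succ]
        simp only [hle, false_and, decide_false, Bool.toNat_false]
        ring
    refine ⟨hv, hlf, hpar, ?_, hnum⟩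
    have hcv := hχ v
    have hcw := hχ w'
    rcases lt_trichotomy (T.height v) r with hvr | hvr | hvr
    · have hdel : (T.advice col χ r v).delay (T.collected col χ r w') =
          χ + col v - col w' - 1 := by
        rw [Advice.delay, advice, if_pos hv]
        simp only [hvr, hvr.ne, and_false, decide_false, Bool.false_eq_true, if_false,
          if_neg (show T.height v ≠ 0 by omega), if_true, hit]
      rw [hdel, slot, slot, if_pos hvr, if_pos (by omega), ← hh, Nat.mul_succ]
      omega
    · -- the node starts the second part of the schedule
      have hdel : (T.advice col χ r v).delay (T.collected col χ r w') =
          T.target col χ r (T.top v) := by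
        have hst : (T.advice col χ r v).starter = true := by
          rw [advice, if_pos hv]
          exact decide_eq_true ⟨by omega, hvr⟩
        rw [Advice.delay, if_pos hst, ← hnum, collected, hvr]
        simp
      have hmul : r * χ = χ * T.height w' + χ := by
        rw [← hvr, ← hh, Nat.succ_mul, Nat.mul_comm]
      rw [hvr] at hit
      rw [hdel, target, if_neg (by omega), hit, slot, slot, if_neg (by omega), if_pos (by omega),
        hmul]
      omega
    · have hdel : (T.advice col χ r v).delay (T.collected col χ r w') = 0 := by
        rw [Advice.delay, advice, if_pos hv]
        simp only [hvr.ne', and_false, decide_false, Bool.false_eq_true, if_false,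
          if_neg (show T.height v ≠ 0 by omega), if_neg (show ¬ T.height v < r by omega)]
      rw [hdel, slot, slot, if_neg (by omega), if_neg (by omega), htop']
      omega

end GatheringTree

/-! ### Colourings -/

open Finset in
/-- Greedy colouring: if every node conflicts with at most `N` others, `N + 1` colours suffice. -/
theorem exists_greedy_coloring {V : Type} [Fintype V] (R : V → V → Prop)
    (hsymm : ∀ u v, R u v → R v u) (N : ℕ) (B : V → Finset V) (hB : ∀ v u, R v u → u ∈ B v)
    (hcard : ∀ v, (B v).card ≤ N) :
    ∃ col : V → ℕ, (∀ v, col v < N + 1) ∧ ∀ u v, u ≠ v → R u v → col u ≠ col v := by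
  classical
  have key : ∀ s : Finset V, ∃ col : V → ℕ, (∀ v, col v < N + 1) ∧
      ∀ u ∈ s, ∀ v ∈ s, u ≠ v → R u v → col u ≠ col v := by
    intro s
    induction s using Finset.induction_on with
    | empty => exact ⟨fun _ => 0, fun _ => Nat.succ_pos _, by simp⟩
    | insert a s ha ih =>
      obtain ⟨col, hlt, hcol⟩ := ih
      obtain ⟨c, hc, hcn⟩ : ∃ c ∈ range (N + 1), c ∉ (B a).image col := by
        apply exists_mem_notMem_of_card_lt_card
        rw [card_range]
        exact Nat.lt_succ_of_le (card_image_le.trans (hcard a))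
      have hfree : ∀ v, R a v → col v ≠ c := fun v hv h =>
        hcn (mem_image.2 ⟨v, hB a v hv, h⟩)
      refine ⟨Function.update col a c, fun v => ?_, fun u hu v hv huv hR => ?_⟩
      · by_cases h : v = a
        · subst h; simpa using hc
        · simpa [h] using hlt v
      · rw [mem_insert] at hu hv
        by_cases h1 : u = a
        · subst h1
          simpa [huv.symm] using (hfree v hR).symm
        · by_cases h2 : v = a
          · subst h2
            simpa [h1] using hfree u (hsymm _ _ hR)
          · simpa [h1, h2] using
              hcol u (hu.resolve_left h1) v (hv.resolve_left h2) huv hR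
  obtain ⟨col, h1, h2⟩ := key univ
  exact ⟨col, h1, fun u v => h2 u (mem_univ _) v (mem_univ _)⟩

open Finset Classical in
theorem exists_distance_two_coloring {V : Type} [Fintype V] (G : SimpleGraph V) {Δ : ℕ}
    (hΔ : ∀ v, (univ.filter fun u => G.Adj v u).card ≤ Δ) :
    ∃ col : V → ℕ, (∀ v, col v < Δ ^ 2 + Δ + 1) ∧
      ∀ u w, u ≠ w → (G.Adj u w ∨ ∃ x, G.Adj x u ∧ G.Adj x w) → col u ≠ col w := by
  refine exists_greedy_coloring (fun u w => G.Adj u w ∨ ∃ x, G.Adj x u ∧ G.Adj x w) ?_ (Δ ^ 2 + Δ)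
    (fun v => (univ.filter fun u => G.Adj v u).biUnion (fun x => univ.filter fun u => G.Adj x u) ∪
      (univ.filter fun u => G.Adj v u)) ?_ fun v => ?_
  · rintro u v (h | ⟨x, h1, h2⟩)
    · exact .inl h.symm
    · exact .inr ⟨x, h2, h1⟩
  · rintro v u (h | ⟨x, h1, h2⟩)
    · exact mem_union_right _ (by simpa using h)
    · exact mem_union_left _ (mem_biUnion.2 ⟨x, by simpa using h1.symm, by simpa using h2⟩)
  · refine (card_union_le _ _).trans (Nat.add_le_add ?_ (hΔ v))
    rw [sq]
    exact card_biUnion_le_card_mul _ _ _ (fun x _ => hΔ x) |>.trans (Nat.mul_le_mul_right _ (hΔ v))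

namespace GatheringTree

variable {V : Type} {G : SimpleGraph V} {S : Finset V} {z : V} (T : GatheringTree G S z)

/-- The rank of the source on top and the depth modulo `3` determine an active node up to nodes at
distance at least three. -/
theorem exists_isColoring (hS : S.Nonempty) :
    ∃ col : V → ℕ, T.IsColoring col ∧ ∀ v, col v < 3 * S.card := by
  classical
  refine ⟨fun v => if T.Active v then 3 * T.rank (T.top v) + T.depth v % 3 else 0,
    fun u w hu hw hne h heq => hne ?_, fun v => ?_⟩
  · dsimp only at heq
    rw [if_pos hu, if_pos hw] at heq
    have hd : T.depth u ≤ T.depth w + 2 ∧ T.depth w ≤ T.depth u + 2 := by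
      rcases h with h | ⟨x, h1, h2⟩
      · have := T.depth_le_of_adj _ _ h
        have := T.depth_le_of_adj _ _ h.symm
        omega
      · have := T.depth_le_of_adj _ _ h1
        have := T.depth_le_of_adj _ _ h1.symm
        have := T.depth_le_of_adj _ _ h2
        have := T.depth_le_of_adj _ _ h2.symm
        omega
    exact hu.eq_of_top_eq hw ((hu.top_eq_iff hw.above_top.1).2 (by omega)) (by omega)
  · dsimp only
    split_ifs with hv
    · have := T.rank_lt _ hv.above_top.1
      omega
    · have := hS.card_pos
      omega

theorem Active.height_le {T : GatheringTree G S z} {v : V} (hv : T.Active v) {D : ℕ}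
    (hD : ∀ v, T.depth v ≤ D) : T.height v ≤ D := by
  have := hv.height_add_depth
  have := hD (T.top v)
  omega

theorem slot_lt {col : V → ℕ} {χ r D : ℕ} (hχ : ∀ v, col v < χ) (hD : ∀ v, T.depth v ≤ D) {v : V}
    (hv : T.Active v) : T.slot col χ r v < r * χ + D + 3 * S.card := by
  have h1 := hv.height_le hD
  have h2 := T.rank_lt _ hv.above_top.1
  have h3 := hχ v
  rw [slot]
  split_ifs with h
  · have := Nat.mul_le_mul_left χ (Nat.succ_le_of_lt h)
    rw [Nat.mul_succ, Nat.mul_comm χ r] at this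
    omega
  · omega

theorem advice_le {col : V → ℕ} {χ r : ℕ} (hχ : ∀ v, col v < χ) (v : V) :
    (T.advice col χ r v).addr ≤ χ + 1 ∧ (T.advice col χ r v).paddr ≤ χ + 1 ∧
      (T.advice col χ r v).wait ≤ if r = 0 then 3 * S.card else 2 * χ := by
  have h1 := hχ v
  have h2 := hχ (T.par v)
  by_cases hv : T.Active v
  · have h3 := T.rank_lt _ hv.above_top.1
    rw [advice, if_pos hv]
    refine ⟨?_, ?_, ?_⟩ <;> dsimp only
    · omega
    · split_ifs <;> omega
    · rcases Nat.eq_zero_or_pos r with rfl | hr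
      · rw [if_pos rfl]
        split_ifs with h4
        · rw [slot, if_neg (Nat.not_lt_zero _), h4]; omega
        · omega
        · omega
      · rw [if_neg hr.ne']
        split_ifs with h4
        · rw [slot, if_pos (by omega), h4]; omega
        · omega
        · omega
  · rw [advice, if_neg hv]
    exact ⟨Nat.zero_le _, Nat.zero_le _, Nat.zero_le _⟩

end GatheringTree

/-! ### Labels -/

/-- The number with the given binary digits, least significant digit first. -/
def natOfBits (l : List Bool) : ℕ := l.foldr Nat.bit 0

theorem natOfBits_bits (n : ℕ) : natOfBits n.bits = n := by
  induction n using Nat.binaryRec' with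
  | zero => rfl
  | bit b n h ih =>
    rw [Nat.bits_append_bit n b h]
    exact congrArg (Nat.bit b) ih

/-- The advice in a number: the four bits are packed into one number. -/
def Advice.ofNat (n : ℕ) : Advice where
  leaf := n.unpair.2.unpair.2.testBit 0
  main := n.unpair.2.unpair.2.testBit 1
  starter := n.unpair.2.unpair.2.testBit 2
  bit := n.unpair.2.unpair.2.testBit 3
  wait := n.unpair.1.unpair.1
  addr := n.unpair.1.unpair.2
  paddr := n.unpair.2.unpair.1

/-- The code of an advice as a number. -/
def Advice.toNat (a : Advice) : ℕ :=
  Nat.pair (Nat.pair a.wait a.addr)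
    (Nat.pair a.paddr (natOfBits [a.leaf, a.main, a.starter, a.bit]))

theorem Advice.ofNat_toNat (a : Advice) : Advice.ofNat a.toNat = a := by
  obtain ⟨a, b, c, d, w, x, y⟩ := a
  simp only [Advice.ofNat, Advice.toNat, Nat.unpair_pair]
  congr 1 <;> revert a b c d <;> decide

theorem Nat.pair_lt_two_pow {a b q : ℕ} (ha : a < 2 ^ q) (hb : b < 2 ^ q) :
    Nat.pair a b < 2 ^ (2 * q) := by
  refine (Nat.pair_lt_max_add_one_sq a b).trans_le ?_
  rw [mul_comm, pow_mul]
  exact Nat.pow_le_pow_left (by omega) 2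

theorem Advice.length_bits_le (a : Advice) {q : ℕ} (hq : 4 ≤ q) (hw : a.wait < 2 ^ q)
    (ha : a.addr < 2 ^ q) (hp : a.paddr < 2 ^ q) : a.toNat.bits.length ≤ 4 * q := by
  rw [Nat.size_eq_bits_len, Nat.size_le]
  have hflags : natOfBits [a.leaf, a.main, a.starter, a.bit] < 2 ^ q := by
    refine lt_of_lt_of_le (b := 2 ^ 4) ?_ (Nat.pow_le_pow_right (by norm_num) hq)
    cases a.leaf <;> cases a.main <;> cases a.starter <;> cases a.bit <;> decide
  have := Nat.pair_lt_two_pow (Nat.pair_lt_two_pow hw ha) (Nat.pair_lt_two_pow hp hflags)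
  rwa [show 2 * (2 * q) = 4 * q by ring] at this

/-! ### Gathering with advice -/

theorem size_le_logb_add_one (n : ℕ) : (n.size : ℝ) ≤ Real.logb 2 n + 1 := by
  rcases Nat.eq_zero_or_pos n with rfl | hn
  · simp
  have hs : 0 < n.size := Nat.size_pos.2 hn
  have h : 2 ^ (n.size - 1) ≤ n := Nat.lt_size.1 (by omega)
  have h' : ((2 : ℝ) ^ ((n.size - 1 : ℕ) : ℝ)) ≤ n := by
    rw [Real.rpow_natCast]; exact_mod_cast h
  have := (Real.le_logb_iff_rpow_le (by norm_num) (by exact_mod_cast hn)).2 h'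
  rw [Nat.cast_sub hs] at this
  push_cast at this
  linarith

theorem add_three_sq_le_two_pow (s : ℕ) : (s + 3) ^ 2 ≤ 16 * 2 ^ s := by
  induction s with
  | zero => norm_num
  | succ s ih => 
    have : (s + 1 + 3) ^ 2 ≤ 2 * (s + 3) ^ 2 := by nlinarith [Nat.zero_le (s * s)]
    rw [pow_succ 2 s]
    omega

/-- A tree with suitable parameters gives labels with which the messages are gathered. -/
theorem exists_labels {n D k : ℕ} (I : GatheringInstance n D k)
    (T : GatheringTree I.graph I.sources I.sink) (hTD : ∀ v, T.depth v ≤ D) {col : Fin n → ℕ}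
    {χ r q : ℕ} (hcol : T.IsColoring col) (hχ : ∀ v, col v < χ)
    (hr : 0 < r → χ + r + 3 * k ≤ 2 ^ (r + 1)) (hq : 4 ≤ q) (hχq : χ + 1 < 2 ^ q)
    (hwq : (if r = 0 then 3 * k else 2 * χ) < 2 ^ q) :
    ∃ lab : Fin n → List Bool, (∀ v, (lab v).length ≤ 4 * q) ∧
      I.SolvedWithin (relayAlgorithm fun l => Advice.ofNat (natOfBits l)) lab
        (r * χ + D + 3 * k) := by
  have hk := I.card_sources
  refine ⟨fun v => (T.advice col χ r v).toNat.bits, fun v => ?_, fun s hs => ?_⟩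
  · obtain ⟨h1, h2, h3⟩ := T.advice_le (r := r) hχ v
    rw [hk] at h3
    exact Advice.length_bits_le _ hq (by omega) (by omega) (by omega)
  · have h := T.realizesSchedule hcol hχ (r := r) (by rwa [hk])
    have hadv : T.advice col χ r = fun v =>
        Advice.ofNat (natOfBits (T.advice col χ r v).toNat.bits) := by
      funext v
      rw [natOfBits_bits, Advice.ofNat_toNat]
    rw [hadv] at h
    refine RealizesSchedule.known_sink (dec := fun l => Advice.ofNat (natOfBits l))
      (lab := fun v => (T.advice col χ r v).toNat.bits) h (fun v hv => ?_) hs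
    have := T.slot_lt (r := r) hχ hTD hv
    omega

open Real in
/-- If `k ≤ Δ ^ 4`, the labels contain ranks of sources. Otherwise there are so few colours that a
time-division schedule is affordable for the lowest `log k + O(1)` levels, along which each starting
node collects the binary digits of its waiting time. -/
theorem exists_gathering_with_advice :
    ∃ (B : RadioAlgorithm (List Bool)) (C : ℝ), 0 < C ∧
      ∀ (n D k : ℕ) (I : GatheringInstance n D k), 1 ≤ k →
        ∃ lab : Fin n → List Bool,
          (∀ v, ((lab v).length : ℝ) ≤ C * (1 + min (logb 2 k) (logb 2 I.maxDegree))) ∧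
          ∃ T : ℕ, (T : ℝ) ≤ C * ((D : ℝ) + k) ∧ I.SolvedWithin B lab T := by
  classical
  refine ⟨relayAlgorithm fun l => Advice.ofNat (natOfBits l), 24, by norm_num,
    fun n D k I hk => ?_⟩
  obtain ⟨T, hT⟩ := exists_gatheringTree I.connected I.sources I.sink
  have : Nonempty (Fin n) := ⟨I.sink⟩
  have hTD : ∀ v, T.depth v ≤ D := fun v => by
    rw [hT]
    exact (SimpleGraph.dist_le_diam
      (SimpleGraph.connected_iff_ediam_ne_top.1 I.connected)).trans I.diam_eq.le
  set Δ := I.maxDegree with hΔ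
  have hdeg : ∀ v, (Finset.univ.filter fun u => I.graph.Adj v u).card ≤ Δ := fun v => by
    have := I.graph.degree_le_maxDegree v
    rw [← SimpleGraph.card_neighborFinset_eq_degree, SimpleGraph.neighborFinset_eq_filter] at this
    convert this
    rw [hΔ, GatheringInstance.maxDegree]
  have hk1 : (1 : ℝ) ≤ k := by exact_mod_cast hk
  have hlogk : 0 ≤ logb 2 k := logb_nonneg (by norm_num) hk1
  have hlogΔ : 0 ≤ logb 2 Δ := by
    rcases Nat.eq_zero_or_pos Δ with h | h
    · simp [h]
    · exact logb_nonneg (by norm_num) (by exact_mod_cast h)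
  have hsk := Nat.lt_size_self k
  have hsizek := size_le_logb_add_one k
  rcases le_or_gt k (Δ ^ 4) with hkΔ | hkΔ
  · obtain ⟨col, hcol, hχ⟩ := T.exists_isColoring
      (Finset.card_pos.1 (by rw [I.card_sources]; omega))
    rw [I.card_sources] at hχ
    have hpow : 16 * k < 2 ^ (k.size + 4) := by rw [pow_add]; omega
    obtain ⟨lab, hlab, hsol⟩ := exists_labels I T hTD (r := 0) (q := k.size + 4) hcol hχ
      (fun h => absurd h (lt_irrefl 0)) (by omega) (by omega) (by rw [if_pos rfl]; omega)
    refine ⟨lab, fun v => ?_, _, ?_, hsol⟩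
    · have h1 : ((lab v).length : ℝ) ≤ 4 * (k.size + 4) := by exact_mod_cast hlab v
      have h2 : logb 2 k ≤ 4 * logb 2 Δ := by
        have : logb 2 k ≤ logb 2 ((Δ : ℝ) ^ 4) :=
          logb_le_logb_of_le (by norm_num) (by linarith) (by exact_mod_cast hkΔ)
        rwa [logb_pow] at this
      rcases min_choice (logb 2 (k : ℝ)) (logb 2 (Δ : ℝ)) with h | h <;> rw [h] <;> linarith
    · push_cast
      have : (0 : ℝ) ≤ D := by positivity
      linarith
  · obtain ⟨col, hχ, hcol⟩ := exists_distance_two_coloring I.graph hdeg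
    have hΔ2 : Δ ^ 2 ≤ Δ ^ 4 := by
      rcases Nat.eq_zero_or_pos Δ with h | h
      · simp [h]
      · exact Nat.pow_le_pow_right h (by norm_num)
    have hΔ1 : Δ ≤ Δ ^ 2 := Nat.le_self_pow (by norm_num) Δ
    have hsize : k.size ≤ k := Nat.size_le.2 Nat.lt_two_pow_self
    have hsz2 : 2 ^ k.size ≤ 2 * k := by
      have hs : 0 < k.size := Nat.size_pos.2 hk
      have h : 2 ^ (k.size - 1) ≤ k := Nat.lt_size.1 (by omega)
      calc 2 ^ k.size = 2 * 2 ^ (k.size - 1) := by rw [← pow_succ']; congr 1; omega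
        _ ≤ 2 * k := by omega
    have hsΔ := Nat.lt_size_self Δ
    have hΔsq : Δ ^ 2 < 2 ^ (2 * Δ.size) := by
      rw [mul_comm, pow_mul]
      exact Nat.pow_lt_pow_left hsΔ (by norm_num)
    have hq : 2 ^ (2 * Δ.size + 4) = 16 * 2 ^ (2 * Δ.size) := by rw [pow_add]; ring
    obtain ⟨lab, hlab, hsol⟩ := exists_labels I T hTD (r := k.size + 3) (q := 2 * Δ.size + 4)
      (fun u w _ _ hne h => hcol u w hne h) hχ (fun _ => by
        rw [show k.size + 3 + 1 = k.size + 4 by omega, pow_add]; omega) (by omega) (by omega)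
        (by rw [if_neg (by omega)]; omega)
    refine ⟨lab, fun v => ?_, _, ?_, hsol⟩
    · have h1 : ((lab v).length : ℝ) ≤ 4 * (2 * Δ.size + 4) := by exact_mod_cast hlab v
      have h2 := size_le_logb_add_one Δ
      have h3 : logb 2 Δ ≤ logb 2 k := by
        rcases Nat.eq_zero_or_pos Δ with h | h
        · simpa [h] using hlogk
        · exact logb_le_logb_of_le (by norm_num) (by exact_mod_cast h)
            (by exact_mod_cast (by omega : Δ ≤ k))
      rw [min_eq_right h3]
      linarith
    · have hrχ : (k.size + 3) * (Δ ^ 2 + Δ + 1) ≤ 21 * k := by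
        have h1 : (k.size + 3) ^ 2 ≤ 32 * k := (add_three_sq_le_two_pow _).trans (by omega)
        have h2 : (Δ ^ 2 + Δ + 1) ^ 2 ≤ 9 * k := by
          rcases Nat.eq_zero_or_pos Δ with h | h
          · rw [h]; omega
          · calc (Δ ^ 2 + Δ + 1) ^ 2 ≤ (3 * Δ ^ 2) ^ 2 :=
                  Nat.pow_le_pow_left (by have := Nat.pow_pos (n := 2) h; omega) 2
              _ = 9 * Δ ^ 4 := by ring
              _ ≤ 9 * k := by omega
        nlinarith [two_mul_le_add_sq (k.size + 3) (Δ ^ 2 + Δ + 1)]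
      have : (k.size + 3) * (Δ ^ 2 + Δ + 1) + D + 3 * k ≤ 24 * (D + k) := by omega
      exact_mod_cast this

theorem mainTheorem6 :
    -- the lower bound for algorithms with arbitrary distinct IDs
    (∃ c : ℝ, 0 < c ∧ ∀ n D k : ℕ, 2 ≤ D → 1 ≤ k → 2 * D + k ≤ n + 1 →
      ∀ A : RadioAlgorithm (ℕ × Bool),
        RequiresRounds n D k A
          (c * ((D : ℝ) * Real.logb 2 n + (k : ℝ) * Real.logb 2 ((n : ℝ) / k)))) ∧
    -- the logarithmic gap: with short advice `O(D + k)` rounds are enough, whereas with distinct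
    -- IDs a factor of `log n` more is required
    (∃ (B : RadioAlgorithm (List Bool)) (C : ℝ), 0 < C ∧
      ∀ (n D k : ℕ) (I : GatheringInstance n D k), 1 ≤ k →
        ∃ lab : Fin n → List Bool,
          (∀ v, ((lab v).length : ℝ) ≤
            C * (1 + min (Real.logb 2 k) (Real.logb 2 I.maxDegree))) ∧
          ∃ T : ℕ, (T : ℝ) ≤ C * ((D : ℝ) + k) ∧ I.SolvedWithin B lab T) ∧
    (∀ ε K : ℝ, 0 < ε → ε < 1 → 0 < K → ∃ c : ℝ, 0 < c ∧
      ∀ n D k : ℕ, 2 ≤ D → 1 ≤ k → 2 * D + k ≤ n + 1 → (k : ℝ) ≤ K * (n : ℝ) ^ ε →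
        ∀ A : RadioAlgorithm (ℕ × Bool),
          RequiresRounds n D k A (c * Real.logb 2 n * ((D : ℝ) + k))) :=
  ⟨⟨1 / 72, by norm_num, fun _ _ _ hD hk hn A => requiresRounds_add hD hk hn A⟩,
    exists_gathering_with_advice,
    fun _ _ hε hε1 hK => exists_requiresRounds_of_le_rpow hε1 hK hε⟩
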